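/- Let $G$ be a finitely generated group with a normal subgroup $K$ such that $K$ is torsion-free nilpotent of finite Prüfer rank and $H=G/K$ is virtually abelian (an $\mathcal M$-group). Let $K^{\mathbb Q}$ be the rational Mal'cev completion of $K$: the torsion-free, nilpotent, radicable group (unique up to isomorphism) containing $K$ in which every element has a positive power in $K$; for $x\in K^{\mathbb Q}$ and $q\in\mathbb Q$ the power $x^q\in K^{\mathbb Q}$ is defined. Fix * a normal subgroup $\mathbb Z^n\lhd H$ of finite index, and its preimage $\bar G$ in $G$; * a finitely generated subgroup $\bar K\le K$ with $\bar K^{\mathbb Q}=K^{\mathbb Q}$ (i.e. every element of $K$ has a positive power in $\bar K$), with a Mal'cev basis $k_1,\dots,k_m$: there is a central series $\bar K=S_1\ge S_2\ge\dots\ge S_{m+1}=\{e\}$ of normal subgroups with $S_i/S_{i+1}$ infinite cyclic and $S_i=\langle k_i,S_{i+1}\rangle$; * lifts $h_1,\dots,h_n\in G$ of the standard basis of $\mathbb Z^n$ such that $\{k_i,h_j\}$ generates $\bar G$; * representatives $f_1,\dots,f_{[H:\mathbb Z^n]-1}\in G$ of the non-trivial cosets of $\bar G$ in $G$. For $r>0$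 let $B_G(r)$, $B_{\bar G}(r)$ be the balls of radius $r$ around $e$ for the word metrics of the generating sets $\{k_i,h_j,f_s\}$ of $G$ and $\{k_i,h_j\}$ of $\bar G$. Then: 1. There is a constant $C>0$ such that for all $r>0$ every $g\in B_G(r)\cap K$ can be written in $K^{\mathbb Q}$ as $g=k_1^{z_1}\cdots k_m^{z_m}$ with $z_i\in\mathbb Q$ and $|z_i|\le C^r$ for all $i$. The same holds (with some constant) for $B_{\bar G}(r)\cap K$. 2. If $H$ is finite, there is a constant $C'>0$ such that for all $r>0$ every $g\in B_G(r)\cap K$ can be written as $g=k_1^{z_1}\cdots k_m^{z_m}$ with $z_i\in\mathbb Z$ and $|z_i|\le C' r^{m^m}$ for all $i$. 3. If $K=\bar K$, there is a constant $C'>0$ such that for all $r>0$ every $g\in B_K(r)$ (the ball of $K$ for the generators $k_1,\dots,k_m$) can be written as $g=k_1^{z_1}\cdots k_m^{z_m}$ with $z_i\in\mathbb Z$ and $|z_i|\le C' r^{m^m}$ for all $i$. -/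

import Mathlib

namespace MGroup

/-- A group is torsion-free if no non-trivial element has finite order. -/
def TorsionFree (G : Type*) [Group G] : Prop :=
  ∀ g : G, g ≠ 1 → ¬ IsOfFinOrder g

/-- A group is virtually abelian if it has an abelian subgroup of finite index. -/
def VirtuallyAbelian (G : Type*) [Group G] : Prop :=
  ∃ A : Subgroup G, IsMulCommutative A ∧ A.FiniteIndex

/-- Finite Prüfer rank: there is `d` such that every finitely generated subgroup can be generated
by at most `d` elements. -/
def FinitePruferRank (G : Type*) [Group G] : Prop :=
  ∃ d : ℕ, ∀ S : Subgroup G, S.FG →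
    ∃ T : Finset G, T.card ≤ d ∧ Subgroup.closure (T : Set G) = S

/-- `G` is a finitely generated group which is an extension `1 → K → G → G ⧸ K → 1` with
`K` torsion-free nilpotent of finite Prüfer rank and `G ⧸ K` virtually abelian. -/
structure IsMExtension (G : Type*) [Group G] (K : Subgroup G) [K.Normal] : Prop where
  fg : Group.FG G
  torsionFree : TorsionFree K
  nilpotent : Group.IsNilpotent K
  finiteRank : FinitePruferRank K
  virtuallyAbelian : VirtuallyAbelian (G ⧸ K)

/-- `g 0, …, g (m-1)` is a Mal'cev basis of `G`: there is a central series
`⊤ = S 0 ≥ S 1 ≥ … ≥ S m = ⊥` of normal subgroups such that each `S i / S (i+1)` is infinite cyclic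
and `S i` is generated by `g i` and `S (i+1)`. (As the coset of `g i` generates the quotient,
the quotient is infinite cyclic exactly when no non-trivial power of `g i` lies in `S (i+1)`.) -/
def IsMalcevBasis {G : Type*} [Group G] {m : ℕ} (g : Fin m → G) : Prop :=
  ∃ S : Fin (m + 1) → Subgroup G,
    S 0 = ⊤ ∧ S (Fin.last m) = ⊥ ∧ (∀ i, (S i).Normal) ∧
    ∀ i : Fin m,
      S i.succ ≤ S i.castSucc ∧
      (∀ x ∈ S i.castSucc, ∀ y : G, x * y * x⁻¹ * y⁻¹ ∈ S i.succ) ∧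
      Subgroup.closure (insert (g i) (S i.succ : Set G)) = S i.castSucc ∧
      ∀ z : ℤ, g i ^ z ∈ S i.succ → z = 0

/-- Unique extraction of roots of every positive order. -/
def Radicable (N : Type*) [Group N] : Prop :=
  ∀ q : ℕ, 0 < q → ∀ x : N, ∃! y : N, y ^ q = x

/-- The rational power `x ^ (p / q)`: the unique `q`-th root of `x ^ p`. -/
noncomputable def ratPow {N : Type*} [Group N] (hN : Radicable N) (x : N) (z : ℚ) : N :=
  (hN z.den z.den_pos (x ^ z.num)).choose

/-- `ι : K → N` is the rational Mal'cev completion of the torsion-free nilpotent group `K`, which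
is unique up to isomorphism: `N` is torsion-free, nilpotent and radicable, `ι` is an embedding, and
every element of `N` has a positive power in the image of `K`. -/
structure IsRationalCompletion {K N : Type*} [Group K] [Group N] (ι : K →* N) : Prop where
  torsionFree : TorsionFree N
  nilpotent : Group.IsNilpotent N
  radicable : Radicable N
  injective : Function.Injective ι
  exists_pow_mem : ∀ x : N, ∃ q : ℕ, 0 < q ∧ x ^ q ∈ ι.range

/-- The word ball of radius `r` for `S`: the products `s₁^{±1} ⋯ s_k^{±1}` with `s_i ∈ S`
and `k ≤ r`. -/
def wordBall {G : Type*} [Group G] (S : Set G) (r : ℝ) : Set G :=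
  {g | ∃ l : List G, (∀ x ∈ l, x ∈ S ∨ x⁻¹ ∈ S) ∧ (l.length : ℝ) ≤ r ∧ l.prod = g}

/-- The preimage in `G` of a subgroup of `G ⧸ K`. -/
def preimage {G : Type*} [Group G] (K : Subgroup G) [K.Normal] (Z : Subgroup (G ⧸ K)) :
    Subgroup G :=
  Z.comap (QuotientGroup.mk' K)

/-- The fixed subgroups and generators attached to an extension `1 → K → G → H → 1`, `H = G ⧸ K`. -/
structure Generators (G : Type*) [Group G] (K : Subgroup G) [K.Normal] (m n : ℕ) where
  /-- The subgroup `K̄` of `K`. -/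
  Kbar : Subgroup K
  /-- `K̄` and `K` have the same rational Mal'cev completion, i.e. every element of `K` has a
  positive power in `K̄`. -/
  exists_pow_mem : ∀ x : K, ∃ q : ℕ, 0 < q ∧ x ^ q ∈ Kbar
  /-- The Mal'cev basis `k₁, …, k_m` of `K̄`. -/
  k : Fin m → Kbar
  isMalcevBasis : IsMalcevBasis k
  /-- The normal free abelian subgroup `ℤⁿ` of finite index in `H`. -/
  Z : Subgroup (G ⧸ K)
  normal : Z.Normal
  finiteIndex : Z.FiniteIndex
  /-- The identification of `Z` with `ℤⁿ`. -/
  e : Multiplicative (Fin n → ℤ) ≃* Z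
  /-- Lifts `h₁, …, h_n` of the standard basis of `ℤⁿ`. -/
  h : Fin n → G
  h_spec : ∀ j, (h j : G ⧸ K) = (e (Multiplicative.ofAdd (Pi.single j 1)) : G ⧸ K)
  /-- The `k_i` and `h_j` generate the preimage `Ḡ` of `ℤⁿ`. -/
  closure_eq : Subgroup.closure
    (Set.range (fun i => ((k i : K) : G)) ∪ Set.range h) = preimage K Z
  /-- Representatives of the non-trivial cosets of `Ḡ` in `G`, equivalently of `ℤⁿ` in `H`. -/
  f : Fin (Z.index - 1) → G
  range_f : Set.range (fun s => (f s : G ⧸ preimage K Z)) = {((1 : G) : G ⧸ preimage K Z)}ᶜ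

namespace Generators

variable {G : Type*} [Group G] {K : Subgroup G} [K.Normal] {m n : ℕ}

/-- The generators `k₁, …, k_m` as a subset of `K`. -/
def gensK (D : Generators G K m n) : Set K :=
  Set.range (fun i => (D.k i : K))

/-- The generating set `{k_i, h_j}` of `Ḡ`, as a subset of `G`. -/
def gensGbar (D : Generators G K m n) : Set G :=
  Set.range (fun i => ((D.k i : K) : G)) ∪ Set.range D.h

/-- The generating set `{k_i, h_j, f_s}` of `G`. -/
def gensG (D : Generators G K m n) : Set G :=
  D.gensGbar ∪ Set.range D.f

/-- The ordered product `k₁^{z₁} ⋯ k_m^{z_m}` with rational exponents, in the completion of `K`. -/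
noncomputable def ratProd (D : Generators G K m n) {N : Type*} [Group N] {ι : K →* N}
    (hι : IsRationalCompletion ι) (z : Fin m → ℚ) : N :=
  (List.ofFn fun i => ratPow hι.radicable (ι (D.k i)) (z i)).prod

/-- The ordered product `k₁^{z₁} ⋯ k_m^{z_m}` with integer exponents. -/
def intProd (D : Generators G K m n) (z : Fin m → ℤ) : K :=
  (List.ofFn fun i => (D.k i : K) ^ z i).prod

end Generators

end MGroup

namespace MGroup

/-! ### Word balls: monotonicity, products, inverses, homomorphic images. -/

section WordBall

variable {G : Type*} [Group G]

/-! The integer bounds come from collection in a nilpotent group. Conjugating a fixed element of S_j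
by g^t lengthens it only polynomially in t, since each commutator with g falls one step down the
central series (`exists_conj_pow_mem_wordBall`). Hence a word of length n in k_i, k_{i+1}, … is
k_i^z with |z| ≤ n times a word of length O(n^m) in the later letters, and m rounds of this give
exponents O(r^(m^m)). If H is finite then n = 0, and Schreier rewriting reduces words in G to words
in the k_i at linear cost.

The exponential bound is linear algebra on polynomial functions on K, those killed by c-fold
differences. They form a finite-dimensional space on which G acts by conjugation, so words of length
N act with norm at most A^N. Differences lower the degree, so translating by a product of M elements
costs only a polynomial of degree c in M and the norms of their difference operators
(`size_translate_list_prod_le`). A word of length N lying in K is a product of at most N^2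
conjugates, by words of length at most N, of finitely many relators: this is the quadratic filling
of ℤ^n (`list_prod_mem_wordBall_conjSet`). So every polynomial function on K grows at most
exponentially.

It remains to choose the exponents z_i as polynomial functions
(`IsCentralSeries.exists_coordinates`). Rational powers of the later k_l generate a central series
of K^ℚ whose quotients have unique roots. On its i-th term the exponent of k_i is a homomorphism,
and splitting off that power of k_i preserves polynomiality (`IsExtendedPoly.exists_isPoly`). -/

theorem wordBall_mono {S T : Set G} (h : S ⊆ T) {r s : ℝ} (hrs : r ≤ s) :
    wordBall S r ⊆ wordBall T s := by
  rintro g ⟨l, hl, hr, rfl⟩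
  exact ⟨l, fun x hx => (hl x hx).imp (fun y => h y) (fun y => h y), hr.trans hrs, rfl⟩

theorem one_mem_wordBall {S : Set G} {r : ℝ} (hr : 0 ≤ r) : (1 : G) ∈ wordBall S r :=
  ⟨[], by simp, by simpa using hr, rfl⟩

theorem mem_wordBall_of_mem {S : Set G} {g : G} (hg : g ∈ S) : g ∈ wordBall S 1 :=
  ⟨[g], by simp [hg], by simp, by simp⟩

theorem mul_mem_wordBall {S : Set G} {r s : ℝ} {g h : G} (hg : g ∈ wordBall S r)
    (hh : h ∈ wordBall S s) : g * h ∈ wordBall S (r + s) := by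
  obtain ⟨l, hl, hr, rfl⟩ := hg
  obtain ⟨l', hl', hr', rfl⟩ := hh
  refine ⟨l ++ l', fun x hx => ?_, by push_cast [List.length_append]; linarith, by simp⟩
  rcases List.mem_append.1 hx with h | h
  exacts [hl x h, hl' x h]

theorem inv_mem_wordBall {S : Set G} {r : ℝ} {g : G} (hg : g ∈ wordBall S r) :
    g⁻¹ ∈ wordBall S r := by
  obtain ⟨l, hl, hr, rfl⟩ := hg
  refine ⟨(l.map (·⁻¹)).reverse, fun x hx => ?_, by simpa using hr, by
    rw [List.prod_inv_reverse]⟩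
  simp only [List.mem_reverse, List.mem_map] at hx
  obtain ⟨y, hy, rfl⟩ := hx
  rcases hl y hy with h | h
  · exact Or.inr (by simpa using h)
  · exact Or.inl h

theorem exists_mem_wordBall_of_mem_closure {S : Set G} {g : G} (hg : g ∈ Subgroup.closure S) :
    ∃ n : ℕ, g ∈ wordBall S n := by
  induction hg using Subgroup.closure_induction with
  | mem x hx => exact ⟨1, by simpa using mem_wordBall_of_mem hx⟩
  | one => exact ⟨0, one_mem_wordBall (by simp)⟩
  | mul x y _ _ hx hy =>
    obtain ⟨a, ha⟩ := hx
    obtain ⟨b, hb⟩ := hy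
    exact ⟨a + b, by simpa using mul_mem_wordBall ha hb⟩
  | inv x _ hx =>
    obtain ⟨a, ha⟩ := hx
    exact ⟨a, inv_mem_wordBall ha⟩

theorem eq_one_of_mem_wordBall {S : Set G} {r : ℝ} (hr : r < 1) {g : G} (hg : g ∈ wordBall S r) :
    g = 1 := by
  obtain ⟨l, -, hl, rfl⟩ := hg
  have : l.length < 1 := by exact_mod_cast hl.trans_lt hr
  rw [List.length_eq_zero_iff.1 (by omega : l.length = 0), List.prod_nil]

theorem mem_wordBall_floor {S : Set G} {r : ℝ} {g : G} (hg : g ∈ wordBall S r) :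
    g ∈ wordBall S (⌊r⌋₊ : ℝ) := by
  obtain ⟨l, hl, hr, rfl⟩ := hg
  exact ⟨l, hl, by exact_mod_cast Nat.le_floor hr, rfl⟩

theorem map_mem_wordBall {H : Type*} [Group H] (φ : G →* H) {S : Set G} {T : Set H}
    (hST : ∀ x ∈ S, φ x ∈ T) {r : ℝ} {g : G} (hg : g ∈ wordBall S r) : φ g ∈ wordBall T r := by
  obtain ⟨l, hl, hr, rfl⟩ := hg
  refine ⟨l.map φ, fun x hx => ?_, by simpa using hr, (map_list_prod φ l).symm⟩
  obtain ⟨y, hy, rfl⟩ := List.mem_map.1 hx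
  exact (hl y hy).imp (hST y) (fun h => by rw [← map_inv]; exact hST _ h)

theorem exists_map_eq_of_mem_wordBall {H : Type*} [Group H] (φ : G →* H) {S : Set G} {r : ℝ}
    {h : H} (hh : h ∈ wordBall (φ '' S) r) : ∃ g ∈ wordBall S r, φ g = h := by
  obtain ⟨l, hl, hr, rfl⟩ := hh
  induction l generalizing r with
  | nil => exact ⟨1, one_mem_wordBall (by simpa using hr), by simp⟩
  | cons a l ih =>
    obtain ⟨g, hg, hgl⟩ := ih (r := r - 1) (fun x hx => hl x (List.mem_cons_of_mem _ hx))
      (by simp at hr; linarith)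
    have : ∃ b ∈ wordBall S 1, φ b = a := by
      rcases hl a List.mem_cons_self with ⟨b, hb, hba⟩ | ⟨b, hb, hba⟩
      · exact ⟨b, mem_wordBall_of_mem hb, hba⟩
      · exact ⟨b⁻¹, inv_mem_wordBall (mem_wordBall_of_mem hb), by simp [hba]⟩
    obtain ⟨b, hb, rfl⟩ := this
    refine ⟨b * g, ?_, by simp [hgl]⟩
    simpa using mul_mem_wordBall hb hg

end WordBall

/-! ### Central series indexed by ℕ. -/

section Series

/-- The terms of a sequence from `κ i` on. -/
def tail {G : Type*} (κ : ℕ → G) (i : ℕ) : Set G := {x | ∃ l, i ≤ l ∧ κ l = x}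

theorem tail_anti {G : Type*} (κ : ℕ → G) (i : ℕ) : tail κ (i + 1) ⊆ tail κ i := by
  rintro x ⟨l, hl, rfl⟩
  exact ⟨l, by omega, rfl⟩

/-- A series of subgroups `S 0 ≥ S 1 ≥ …`, central in `S 0` and trivial from `S m` on, such that
`S i` is generated by `κ i` and `S (i + 1)`. -/
structure IsCentralSeries {G : Type*} [Group G] (m : ℕ) (S : ℕ → Subgroup G) (κ : ℕ → G) :
    Prop where
  eq_bot : ∀ i, m ≤ i → S i = ⊥
  le : ∀ i, S (i + 1) ≤ S i
  comm : ∀ i, ∀ x ∈ S i, ∀ y ∈ S 0, x * y * x⁻¹ * y⁻¹ ∈ S (i + 1)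
  closure : ∀ i, Subgroup.closure (insert (κ i) (S (i + 1) : Set G)) = S i

/-- Padding by `⊥` and `1` beyond `m` lets later inductions run over ℕ, downwards from the trivial
terms. -/
theorem IsMalcevBasis.exists_isCentralSeries {G : Type*} [Group G] {m : ℕ} {g : Fin m → G}
    (hg : IsMalcevBasis g) : ∃ (S : ℕ → Subgroup G) (κ : ℕ → G),
      IsCentralSeries m S κ ∧ S 0 = ⊤ ∧ ∀ i : Fin m, κ i = g i := by
  obtain ⟨S, h0, hl, -, h⟩ := hg
  have key : ∀ i (hi : i < m),
      S ⟨i, by omega⟩ = S (Fin.castSucc ⟨i, hi⟩) ∧ S ⟨i + 1, by omega⟩ = S (Fin.succ ⟨i, hi⟩) :=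
    fun i hi => ⟨rfl, rfl⟩
  have hbot : ∀ i, m ≤ i → (if h : i < m then S ⟨i, by omega⟩ else ⊥) = ⊥ := fun i hi => by
    rw [dif_neg (by omega)]
  have hS : ∀ i (hi : i ≤ m), (if h : i < m then S ⟨i, by omega⟩ else ⊥) = S ⟨i, by omega⟩ := by
    intro i hi
    by_cases him : i < m
    · rw [dif_pos him]
    · obtain rfl : i = m := by omega
      rw [dif_neg him]
      exact hl.symm
  refine ⟨fun i => if h : i < m then S ⟨i, by omega⟩ else ⊥,
    fun i => if h : i < m then g ⟨i, h⟩ else 1, ⟨hbot, ?_, ?_, ?_⟩, ?_, fun i => by simp⟩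
  · intro i
    by_cases hi : i < m
    · simp only [hS i hi.le, hS (i + 1) hi]
      exact (h ⟨i, hi⟩).1
    · simp only [hbot (i + 1) (by omega)]
      exact bot_le
  · intro i x hx y _
    by_cases hi : i < m
    · simp only [hS i hi.le, hS (i + 1) hi] at hx ⊢
      exact (h ⟨i, hi⟩).2.1 x hx y
    · simp only [hbot i (by omega), Subgroup.mem_bot] at hx
      simp [hx]
  · intro i
    by_cases hi : i < m
    · simp only [hS i hi.le, hS (i + 1) hi, dif_pos hi]
      exact (h ⟨i, hi⟩).2.2.1
    · simp only [hbot i (by omega), hbot (i + 1) (by omega), dif_neg hi]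
      simp
  · simp only [hS 0 (Nat.zero_le m)]
    exact h0

namespace IsCentralSeries

variable {G : Type*} [Group G] {m : ℕ} {S : ℕ → Subgroup G} {κ : ℕ → G}

theorem map (h : IsCentralSeries m S κ) {H : Type*} [Group H] (φ : G →* H) :
    IsCentralSeries m (fun i => (S i).map φ) (fun i => φ (κ i)) where
  eq_bot i hi := by simp [h.eq_bot i hi]
  le i := Subgroup.map_mono (h.le i)
  comm i := by
    rintro _ ⟨x, hx, rfl⟩ _ ⟨y, hy, rfl⟩
    exact ⟨_, h.comm i x hx y hy, by simp⟩
  closure i := by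
    simp only [← h.closure i, MonoidHom.map_closure, Set.image_insert_eq, Subgroup.coe_map]

theorem antitone (h : IsCentralSeries m S κ) : Antitone S := antitone_nat_of_succ_le h.le

theorem le_zero (h : IsCentralSeries m S κ) (i : ℕ) : S i ≤ S 0 := h.antitone (Nat.zero_le i)

theorem mem (h : IsCentralSeries m S κ) (i : ℕ) : κ i ∈ S i := by
  rw [← h.closure i]
  exact Subgroup.subset_closure (Set.mem_insert _ _)

theorem conj_mul_inv_mem (h : IsCentralSeries m S κ) {i : ℕ} {x y : G} (hx : x ∈ S i)
    (hy : y ∈ S 0) : y * x * y⁻¹ * x⁻¹ ∈ S (i + 1) := by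
  have := (S (i + 1)).inv_mem (h.comm i x hx y hy)
  convert this using 1
  group

theorem closure_tail (h : IsCentralSeries m S κ) (i : ℕ) : Subgroup.closure (tail κ i) = S i := by
  have key : ∀ d i, m ≤ i + d → Subgroup.closure (tail κ i) = S i := by
    intro d
    induction d with
    | zero =>
      intro i hi
      rw [h.eq_bot i (by omega), Subgroup.closure_eq_bot_iff]
      rintro x ⟨l, hl, rfl⟩
      have := h.mem l
      rwa [h.eq_bot l (by omega)] at this
    | succ d ih =>
      intro i hi
      have ih' := ih (i + 1) (by omega)
      apply le_antisymm
      · rw [Subgroup.closure_le]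
        rintro x ⟨l, hl, rfl⟩
        exact h.antitone hl (h.mem l)
      · rw [← h.closure i, Subgroup.closure_le, Set.insert_subset_iff, ← ih']
        exact ⟨Subgroup.subset_closure ⟨i, le_rfl, rfl⟩,
          Subgroup.closure_mono (tail_anti κ i)⟩
  exact key m i (by omega)

end IsCentralSeries

end Series

/-! ### Collection in nilpotent groups and polynomial exponents. -/

section Peel

/-- Factors are split off greedily from the left; `T i` records what is known of the remainder after
`i` steps. -/
theorem exists_ofFn_prod_eq {G F : Type*} [Group G] (N : F → Prop) {m : ℕ} (φ : Fin m → F → G)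
    (T : ℕ → Set G) (hm : T m ⊆ {1})
    (h : ∀ i : Fin m, ∀ g ∈ T i, ∃ z, N z ∧ ∃ g' ∈ T (i + 1), g = φ i z * g') {g : G}
    (hg : g ∈ T 0) : ∃ z : Fin m → F, g = (List.ofFn fun i => φ i (z i)).prod ∧ ∀ i, N (z i) := by
  induction m generalizing T g with
  | zero => exact ⟨Fin.elim0, by simpa using hm hg, fun i => i.elim0⟩
  | succ m ih =>
    obtain ⟨z, hz, g', hg', rfl⟩ := h 0 g hg
    obtain ⟨w, rfl, hw⟩ := ih (fun i => φ i.succ) (fun i => T (i + 1)) hm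
      (fun i g hg => by simpa using h i.succ g (by simpa using hg)) hg'
    refine ⟨Fin.cons z w, by simp, fun i => ?_⟩
    refine Fin.cases ?_ (fun i => ?_) i
    · simpa using hz
    · simpa using hw i

variable {G : Type*} [Group G] {m : ℕ} {S : ℕ → Subgroup G} {κ : ℕ → G}

namespace IsCentralSeries

/-- The conjugates of a fixed element of `S j` by the powers of `g` have polynomially bounded
length. -/
theorem exists_conj_pow_mem_wordBall (h : IsCentralSeries m S κ) {g : G} (hg : g ∈ S 0) (d : ℕ) :
    ∀ j, m ≤ j + d → ∀ u ∈ S j, ∃ C : ℕ, ∀ t : ℕ,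
      g ^ t * u * (g ^ t)⁻¹ ∈ wordBall (tail κ j) ((C * (t + 1) ^ d : ℕ) : ℝ) := by
  induction d with
  | zero =>
    intro j hj u hu
    rw [h.eq_bot j (by omega), Subgroup.mem_bot] at hu
    exact ⟨0, fun t => by simpa [hu] using one_mem_wordBall le_rfl⟩
  | succ d ih =>
    intro j hj u hu
    rw [← h.closure j] at hu
    induction hu using Subgroup.closure_induction with
    | one => exact ⟨0, fun t => by simpa using one_mem_wordBall le_rfl⟩
    | mul x y _ _ hx hy =>
      obtain ⟨C, hC⟩ := hx
      obtain ⟨D, hD⟩ := hy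
      refine ⟨C + D, fun t => ?_⟩
      have := mul_mem_wordBall (hC t) (hD t)
      rw [← Nat.cast_add, ← add_mul] at this
      convert this using 1
      group
    | inv x _ hx =>
      obtain ⟨C, hC⟩ := hx
      refine ⟨C, fun t => ?_⟩
      have := inv_mem_wordBall (hC t)
      convert this using 1
      group
    | mem x hx =>
      rcases hx with rfl | hx
      · obtain ⟨C, hC⟩ := ih (j + 1) (by omega) _ (h.conj_mul_inv_mem (h.mem j) hg)
        refine ⟨C + 1, fun t => ?_⟩
        -- Telescoping: each further conjugation by `g` contributes one conjugate of the commutator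
        -- of `g` and `κ j`, which lies one step lower and is bounded by `ih`.
        have key : ∀ t : ℕ, g ^ t * κ j * (g ^ t)⁻¹ ∈
            wordBall (tail κ j) ((1 + t * (C * (t + 1) ^ d) : ℕ) : ℝ) := by
          intro t
          induction t with
          | zero => simpa using mem_wordBall_of_mem (S := tail κ j) ⟨j, le_rfl, rfl⟩
          | succ t iht =>
            have := wordBall_mono (tail_anti κ j) le_rfl (hC t)
            have h2 := mul_mem_wordBall this iht
            have e : g ^ (t + 1) * κ j * (g ^ (t + 1))⁻¹ =
                g ^ t * (g * κ j * g⁻¹ * (κ j)⁻¹) * (g ^ t)⁻¹ * (g ^ t * κ j * (g ^ t)⁻¹) := by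
              rw [pow_succ]; group
            rw [e]
            refine wordBall_mono le_rfl ?_ h2
            rw [← Nat.cast_add]
            norm_cast
            have : (t + 1) ^ d ≤ (t + 1 + 1) ^ d := Nat.pow_le_pow_left (by omega) d
            nlinarith [Nat.zero_le C, Nat.mul_le_mul_left C this,
              Nat.mul_le_mul_left t (Nat.mul_le_mul_left C this)]
        refine wordBall_mono le_rfl ?_ (key t)
        norm_cast
        have : 1 ≤ (t + 1) ^ d := Nat.one_le_pow _ _ (by omega)
        rw [pow_succ]
        nlinarith [Nat.zero_le (C * (t + 1) ^ d)]
      · obtain ⟨C, hC⟩ := ih (j + 1) (by omega) x hx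
        refine ⟨C, fun t => wordBall_mono (tail_anti κ j) ?_ (hC t)⟩
        norm_cast
        exact Nat.mul_le_mul_left _ (Nat.pow_le_pow_right (by omega) (by omega))

/-- Makes the previous bound uniform: both signs of the exponent are covered by adding constants,
and only the letters below `m` are non-trivial. -/
theorem exists_conj_zpow_mem_wordBall (h : IsCentralSeries m S κ) (i : ℕ) :
    ∃ C : ℕ, ∀ x ∈ tail κ (i + 1), ∀ z : ℤ, κ i ^ (-z) * x * κ i ^ z ∈
      wordBall (tail κ (i + 1)) ((C * (z.natAbs + 1) ^ (m - 1) : ℕ) : ℝ) := by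
  have h1 : ∀ l : ℕ, ∃ C : ℕ, i + 1 ≤ l → ∀ z : ℤ, κ i ^ (-z) * κ l * κ i ^ z ∈
      wordBall (tail κ (i + 1)) ((C * (z.natAbs + 1) ^ (m - 1) : ℕ) : ℝ) := by
    intro l
    by_cases hl : i + 1 ≤ l
    · have hi : κ i ∈ S 0 := h.le_zero i (h.mem i)
      have hlm := h.antitone hl (h.mem l)
      obtain ⟨C, hC⟩ := h.exists_conj_pow_mem_wordBall hi (m - 1) (i + 1) (by omega) _ hlm
      obtain ⟨D, hD⟩ := h.exists_conj_pow_mem_wordBall ((S 0).inv_mem hi) (m - 1) (i + 1)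
        (by omega) _ hlm
      refine ⟨C + D, fun _ z => ?_⟩
      obtain ⟨t, rfl | rfl⟩ := z.eq_nat_or_neg
      · refine wordBall_mono le_rfl (s := ((C + D) * (t + 1) ^ (m - 1) : ℕ)) ?_ (r :=
          (D * (t + 1) ^ (m - 1) : ℕ)) ?_
        · norm_cast
          exact Nat.mul_le_mul_right _ (by omega)
        · simpa using hD t
      · simp only [neg_neg, zpow_natCast, Int.natAbs_neg, Int.natAbs_natCast, zpow_neg]
        refine wordBall_mono le_rfl ?_ (hC t)
        norm_cast
        exact Nat.mul_le_mul_right _ (by omega)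
    · exact ⟨0, fun h => absurd h hl⟩
  choose C hC using h1
  refine ⟨∑ l ∈ Finset.range m, C l, ?_⟩
  rintro x ⟨l, hl, rfl⟩ z
  by_cases hlm : l < m
  · refine wordBall_mono le_rfl ?_ (hC l hl z)
    norm_cast
    exact Nat.mul_le_mul_right _
      (Finset.single_le_sum (f := C) (fun _ _ => Nat.zero_le _) (Finset.mem_range.2 hlm))
  · have := h.mem l
    rw [h.eq_bot l (by omega), Subgroup.mem_bot] at this
    rw [this]
    simpa using one_mem_wordBall (by positivity)

/-- A word in `κ i, κ (i + 1), …` is a power of `κ i` times a word in `κ (i + 1), …` of polynomially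
bounded length. -/
theorem exists_zpow_mul_of_mem_wordBall (h : IsCentralSeries m S κ) {i : ℕ} (him : i < m) :
    ∃ C : ℕ, ∀ n : ℕ, 0 < n → ∀ g ∈ wordBall (tail κ i) n, ∃ z : ℤ, z.natAbs ≤ n ∧
      ∃ g' ∈ wordBall (tail κ (i + 1)) ((C * n ^ m : ℕ) : ℝ), g = κ i ^ z * g' := by
  obtain ⟨C, hC⟩ := h.exists_conj_zpow_mem_wordBall i
  refine ⟨C * 2 ^ (m - 1), ?_⟩
  rintro n hn _ ⟨l, hl, hln, rfl⟩
  rw [Nat.cast_le] at hln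
  -- Powers of `κ i` are collected on the left. Any other letter is conjugated by a power with
  -- exponent at most `n`, which costs degree `m - 1` in `n`; there are at most `n` such letters.
  have key : ∃ z : ℤ, z.natAbs ≤ l.length ∧ ∃ g' ∈ wordBall (tail κ (i + 1))
      ((l.length * (C * (n + 1) ^ (m - 1)) : ℕ) : ℝ), l.prod = κ i ^ z * g' := by
    induction l with
    | nil => exact ⟨0, by simp, 1, one_mem_wordBall (by simp), by simp⟩
    | cons a l ih =>
      obtain ⟨z, hz, g', hg', he⟩ := ih (fun x hx => hl x (List.mem_cons_of_mem _ hx))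
        (by simp at hln; omega)
      have hlen : (a :: l).length = l.length + 1 := rfl
      have hcases : (∃ ε : ℤ, ε.natAbs = 1 ∧ a = κ i ^ ε) ∨ a ∈ tail κ (i + 1) ∨
          a⁻¹ ∈ tail κ (i + 1) := by
        rcases hl a List.mem_cons_self with ⟨j, hj, e⟩ | ⟨j, hj, e⟩ <;>
          rcases hj.eq_or_lt with rfl | hj
        · exact Or.inl ⟨1, rfl, by simp [e]⟩
        · exact Or.inr (Or.inl ⟨j, hj, e⟩)
        · exact Or.inl ⟨-1, rfl, by simp [e]⟩
        · exact Or.inr (Or.inr ⟨j, hj, e⟩)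
      have hmono : ((l.length * (C * (n + 1) ^ (m - 1)) : ℕ) : ℝ) ≤
          (((a :: l).length * (C * (n + 1) ^ (m - 1)) : ℕ) : ℝ) := by
        norm_cast
        exact Nat.mul_le_mul_right _ (by omega)
      rcases hcases with ⟨ε, hε, rfl⟩ | ha
      · exact ⟨ε + z, by omega, g', wordBall_mono le_rfl hmono hg', by
          rw [List.prod_cons, he, zpow_add, mul_assoc]⟩
      · have ha' : κ i ^ (-z) * a * κ i ^ z ∈
            wordBall (tail κ (i + 1)) ((C * (z.natAbs + 1) ^ (m - 1) : ℕ) : ℝ) := by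
          rcases ha with ha | ha
          · exact hC a ha z
          · have := inv_mem_wordBall (hC _ ha z)
            convert this using 1
            group
        refine ⟨z, by omega, κ i ^ (-z) * a * κ i ^ z * g', ?_, by
          rw [List.prod_cons, he]; group⟩
        refine wordBall_mono le_rfl ?_ (mul_mem_wordBall ha' hg')
        rw [← Nat.cast_add]
        norm_cast
        have : (z.natAbs + 1) ^ (m - 1) ≤ (n + 1) ^ (m - 1) :=
          Nat.pow_le_pow_left (by omega) _
        rw [hlen, add_mul, one_mul, add_comm]
        exact Nat.add_le_add_left (Nat.mul_le_mul_left _ this) _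
  obtain ⟨z, hz, g', hg', he⟩ := key
  refine ⟨z, by omega, g', wordBall_mono le_rfl ?_ hg', he⟩
  norm_cast
  calc l.length * (C * (n + 1) ^ (m - 1)) ≤ n * (C * (2 * n) ^ (m - 1)) :=
        Nat.mul_le_mul hln (Nat.mul_le_mul_left _ (Nat.pow_le_pow_left (by omega) _))
    _ = C * 2 ^ (m - 1) * n ^ (m - 1 + 1) := by rw [mul_pow, pow_succ]; ring
    _ = C * 2 ^ (m - 1) * n ^ m := by rw [Nat.sub_add_cancel (by omega)]

/-- The exponents of the ordered product of a word are polynomially bounded in its length. -/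
theorem exists_zpow_prod_of_mem_wordBall (h : IsCentralSeries m S κ) :
    ∃ C : ℝ, 0 < C ∧ ∀ r : ℝ, 0 < r → ∀ g ∈ wordBall (tail κ 0) r, ∃ z : Fin m → ℤ,
      g = (List.ofFn fun i : Fin m => κ i ^ z i).prod ∧ ∀ i, |(z i : ℝ)| ≤ C * r ^ (m ^ m) := by
  have hC : ∀ i : ℕ, ∃ C : ℕ, i < m → ∀ n : ℕ, 0 < n → ∀ g ∈ wordBall (tail κ i) n,
      ∃ z : ℤ, z.natAbs ≤ n ∧ ∃ g' ∈ wordBall (tail κ (i + 1)) ((C * n ^ m : ℕ) : ℝ),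
        g = κ i ^ z * g' := fun i => by
    by_cases hi : i < m
    · obtain ⟨C, hC⟩ := h.exists_zpow_mul_of_mem_wordBall hi
      exact ⟨C, fun _ => hC⟩
    · exact ⟨0, fun h => absurd h hi⟩
  choose C hC using hC
  have hD : ∃ D : ℕ, 0 < D ∧ ∀ i < m, C i ≤ D :=
    ⟨∑ i ∈ Finset.range m, C i + 1, by omega, fun i hi => (Finset.single_le_sum (f := C)
      (fun _ _ => Nat.zero_le _) (Finset.mem_range.2 hi)).trans (by omega)⟩
  obtain ⟨D, hD0, hD⟩ := hD
  -- the lengths `E i * n ^ m ^ i` of the successive remainders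
  let E : ℕ → ℕ := fun i => Nat.rec 1 (fun _ e => D * e ^ m) i
  have hE0 : ∀ i, 0 < E i := by
    intro i
    induction i with
    | zero => exact Nat.one_pos
    | succ i ih => exact Nat.mul_pos hD0 (pow_pos ih m)
  have hES : ∀ i n, D * (E i * n ^ m ^ i) ^ m = E (i + 1) * n ^ m ^ (i + 1) := by
    intro i n
    change _ = D * E i ^ m * _
    rw [mul_pow, ← pow_mul, ← pow_succ, mul_assoc]
  refine ⟨∑ i ∈ Finset.range m, E i + 1, by positivity, fun r hr g hg => ?_⟩
  -- For `r < 1` the ball is trivial; otherwise the integer part of `r` is positive, as the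
  -- monotonicity of powers below requires.
  rcases lt_or_ge r 1 with hr1 | hr1
  · refine ⟨0, by simp [eq_one_of_mem_wordBall hr1 hg, List.ofFn_const], fun i => ?_⟩
    simp only [Pi.zero_apply, Int.cast_zero, abs_zero]
    positivity
  · have hn : 0 < ⌊r⌋₊ := Nat.floor_pos.2 hr1
    set n := ⌊r⌋₊ with hn_def
    have key := exists_ofFn_prod_eq (m := m) (g := g)
      (fun z : ℤ => |(z : ℝ)| ≤ (∑ i ∈ Finset.range m, E i + 1 : ℕ) * r ^ m ^ m)
      (fun i z => κ i ^ z) (fun i => wordBall (tail κ i) ((E i * n ^ m ^ i : ℕ) : ℝ))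
    refine (key ?_ ?_ ?_).imp fun z hz => ⟨hz.1, fun i => by exact_mod_cast hz.2 i⟩
    · rintro x ⟨l, hl, -, rfl⟩
      have : l.prod ∈ S m := by
        rw [← h.closure_tail m]
        refine Subgroup.list_prod_mem _ fun x hx => ?_
        rcases hl x hx with hx | hx
        · exact Subgroup.subset_closure hx
        · exact (Subgroup.inv_mem_iff _).1 (Subgroup.subset_closure hx)
      rwa [h.eq_bot m le_rfl] at this
    · intro i x hx
      obtain ⟨z, hz, g', hg', he⟩ := hC i i.2 _ (Nat.mul_pos (hE0 i) (pow_pos hn _)) x hx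
      refine ⟨z, ?_, g', wordBall_mono le_rfl ?_ hg', he⟩
      · have h1 : E i * n ^ m ^ (i : ℕ) ≤ (∑ i ∈ Finset.range m, E i + 1) * n ^ m ^ m := by
          refine Nat.mul_le_mul ((Finset.single_le_sum (f := E) (fun _ _ => Nat.zero_le _)
            (Finset.mem_range.2 i.2)).trans (by omega)) (Nat.pow_le_pow_right hn ?_)
          exact Nat.pow_le_pow_right (Nat.zero_lt_of_lt i.2) i.2.le
        have h2 : |(z : ℝ)| = (z.natAbs : ℝ) := by
          rw [Nat.cast_natAbs, Int.cast_abs]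
        rw [h2]
        calc (z.natAbs : ℝ) ≤ ((∑ i ∈ Finset.range m, E i + 1) * n ^ m ^ m : ℕ) := by
              exact_mod_cast hz.trans h1
          _ = (∑ i ∈ Finset.range m, E i + 1 : ℕ) * (n : ℝ) ^ m ^ m := by push_cast; rfl
          _ ≤ _ := by
            gcongr
            exact Nat.floor_le hr.le
      · rw [← hES]
        norm_cast
        exact Nat.mul_le_mul_right _ (hD i i.2)
    · refine wordBall_mono le_rfl ?_ (mem_wordBall_floor hg)
      simp [E, hn_def]

end IsCentralSeries

end Peel

/-! ### Schreier rewriting in a finite-index subgroup. -/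

/-- In a finite-index subgroup, the word length is at most a multiple of that of the whole group. -/
theorem exists_mem_wordBall_of_finiteIndex {G ι : Type*} [Group G] [Finite ι] {P : Subgroup G}
    {X : Set G} (hX : X.Finite) (hXP : Subgroup.closure X = P) (f : ι → G)
    (hf : Set.range (fun s => (f s : G ⧸ P)) = {((1 : G) : G ⧸ P)}ᶜ) :
    ∃ c : ℕ, 0 < c ∧ ∀ r : ℝ, ∀ g ∈ wordBall (X ∪ Set.range f) r, g ∈ P →
      g ∈ wordBall X (c * r) := by
  let T : Set G := insert 1 (Set.range f)
  have hT : T.Finite := (Set.finite_range f).insert 1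
  have hTP : ∀ t ∈ T, t ∈ P → t = 1 := by
    rintro t (rfl | ⟨s, rfl⟩) ht
    · rfl
    · have : (f s : G ⧸ P) ∈ ({((1 : G) : G ⧸ P)}ᶜ : Set (G ⧸ P)) := hf ▸ ⟨s, rfl⟩
      exact absurd (QuotientGroup.eq.2 (by simpa using ht)) this
  have hcov : ∀ y : G, ∃ t ∈ T, t⁻¹ * y ∈ P := by
    intro y
    by_cases hy : (y : G ⧸ P) = ((1 : G) : G ⧸ P)
    · exact ⟨1, Set.mem_insert _ _, by simpa using QuotientGroup.eq.1 hy.symm⟩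
    · have : (y : G ⧸ P) ∈ Set.range (fun s => (f s : G ⧸ P)) := by rw [hf]; exact hy
      obtain ⟨s, hs⟩ := this
      exact ⟨f s, Set.mem_insert_of_mem _ ⟨s, rfl⟩, QuotientGroup.eq.1 hs⟩
  let A : Set G := (X ∪ Set.range f) ∪ (X ∪ Set.range f)⁻¹
  have hA : A.Finite := (hX.union (Set.finite_range f)).union (hX.union (Set.finite_range f)).inv
  -- Contains the finitely many Schreier generators; `c` below bounds the lengths of those lying in
  -- `P`.
  let Q : Set G := (fun p : G × G × G => p.2.2⁻¹ * p.1 * p.2.1) '' (A ×ˢ T ×ˢ T)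
  have hQ : Q.Finite := (hA.prod (hT.prod hT)).image _
  have hlen : ∀ q : G, ∃ n : ℕ, q ∈ P → q ∈ wordBall X n := fun q => by
    by_cases hq : q ∈ P
    · obtain ⟨n, hn⟩ := exists_mem_wordBall_of_mem_closure (hXP.symm ▸ hq)
      exact ⟨n, fun _ => hn⟩
    · exact ⟨0, fun h => absurd h hq⟩
  choose n hn using hlen
  obtain ⟨c, hc⟩ : ∃ c : ℕ, ∀ q ∈ Q, n q ≤ c := by
    obtain ⟨c, hc⟩ := (hQ.image n).bddAbove
    exact ⟨c, fun q hq => hc ⟨q, hq, rfl⟩⟩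
  refine ⟨c + 1, by omega, ?_⟩
  rintro r _ ⟨l, hl, hlr, rfl⟩ hP
  have key : ∃ t ∈ T, t⁻¹ * l.prod ∈ P ∧ t⁻¹ * l.prod ∈ wordBall X ((c + 1 : ℕ) * l.length) := by
    clear hP hlr
    induction l with
    | nil => exact ⟨1, Set.mem_insert _ _, by simp [P.one_mem], by
        simpa using one_mem_wordBall (S := X) le_rfl⟩
    | cons a l ih =>
      obtain ⟨t, ht, htP, htl⟩ := ih (fun x hx => hl x (List.mem_cons_of_mem _ hx))
      obtain ⟨t', ht', htP'⟩ := hcov (a * t)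
      have ha : a ∈ A := by
        rcases hl a List.mem_cons_self with h | h
        · exact Or.inl h
        · exact Or.inr (by simpa using h)
      have h1 : t'⁻¹ * a * t ∈ wordBall X (c + 1 : ℕ) := by
        refine wordBall_mono le_rfl ?_ (hn _ (by rwa [mul_assoc]))
        exact_mod_cast (hc _ ⟨(a, t, t'), ⟨ha, ht, ht'⟩, rfl⟩).trans (Nat.le_succ c)
      have e : t'⁻¹ * (a :: l).prod = (t'⁻¹ * a * t) * (t⁻¹ * l.prod) := by
        rw [List.prod_cons]; group
      refine ⟨t', ht', ?_, ?_⟩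
      · rw [e]
        exact P.mul_mem (by rwa [mul_assoc]) htP
      · rw [e]
        convert mul_mem_wordBall h1 htl using 2
        push_cast [List.length_cons]
        ring
  obtain ⟨t, ht, htP, htl⟩ := key
  have : t = 1 := hTP t ht <| by
    simpa using P.mul_mem hP (P.inv_mem htP)
  subst this
  refine wordBall_mono le_rfl ?_ (by simpa using htl)
  push_cast
  gcongr

/-! ### Polynomial bounds with integer exponents. -/

namespace Generators

variable {G : Type*} [Group G] {K : Subgroup G} [K.Normal] {m n : ℕ}

theorem finite_gensGbar (D : Generators G K m n) : D.gensGbar.Finite :=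
  (Set.finite_range _).union (Set.finite_range _)

theorem le_preimage (D : Generators G K m n) : K ≤ preimage K D.Z := fun x hx => by
  have : QuotientGroup.mk' K x = 1 := (QuotientGroup.eq_one_iff x).2 hx
  rw [preimage, Subgroup.mem_comap, this]
  exact D.Z.one_mem

theorem exists_mem_wordBall_gensGbar (D : Generators G K m n) : ∃ c : ℕ, 0 < c ∧
    ∀ r : ℝ, ∀ g : K, (g : G) ∈ wordBall D.gensG r → (g : G) ∈ wordBall D.gensGbar (c * r) := by
  obtain ⟨c, hc0, hc⟩ :=
    exists_mem_wordBall_of_finiteIndex D.finite_gensGbar D.closure_eq D.f D.range_f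
  exact ⟨c, hc0, fun r g hg => hc r g hg (D.le_preimage g.2)⟩

theorem exists_intProd_of_mem_wordBall_gensK (D : Generators G K m n) :
    ∃ C : ℝ, 0 < C ∧ ∀ r : ℝ, 0 < r → ∀ g : K, g ∈ wordBall D.gensK r →
      ∃ z : Fin m → ℤ, g = D.intProd z ∧ ∀ i, |(z i : ℝ)| ≤ C * r ^ (m ^ m) := by
  obtain ⟨S, κ, hS, -, hκ⟩ := D.isMalcevBasis.exists_isCentralSeries
  obtain ⟨C, hC0, hC⟩ := (hS.map D.Kbar.subtype).exists_zpow_prod_of_mem_wordBall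
  refine ⟨C, hC0, fun r hr g hg => ?_⟩
  have hsub : D.gensK ⊆ tail (fun i => D.Kbar.subtype (κ i)) 0 := by
    rintro _ ⟨i, rfl⟩
    exact ⟨i, Nat.zero_le _, by simp [hκ]⟩
  obtain ⟨z, hz, hb⟩ := hC r hr g (wordBall_mono hsub le_rfl hg)
  refine ⟨z, ?_, hb⟩
  rw [hz, intProd]
  congr 2
  funext i
  simp [hκ]

/-- A finite group contains ℤ^n only for `n = 0`, so there are no letters `h j`. -/
theorem gensGbar_subset_of_finite (D : Generators G K m n) [Finite (G ⧸ K)] :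
    D.gensGbar ⊆ K.subtype '' D.gensK := by
  have hn : n = 0 := by
    by_contra hn
    have : Nonempty (Fin n) := ⟨⟨0, by omega⟩⟩
    have h1 : Finite (Multiplicative (Fin n → ℤ)) := Finite.of_equiv _ D.e.symm.toEquiv
    have h2 : Finite (Fin n → ℤ) := Finite.of_equiv _ Multiplicative.toAdd
    exact not_finite (Fin n → ℤ)
  subst hn
  rintro x (⟨i, rfl⟩ | ⟨i, rfl⟩)
  · exact ⟨_, ⟨i, rfl⟩, rfl⟩
  · exact i.elim0

theorem exists_intProd_of_finite (D : Generators G K m n) [Finite (G ⧸ K)] :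
    ∃ C : ℝ, 0 < C ∧ ∀ r : ℝ, 0 < r → ∀ g : K, (g : G) ∈ wordBall D.gensG r →
      ∃ z : Fin m → ℤ, g = D.intProd z ∧ ∀ i, |(z i : ℝ)| ≤ C * r ^ (m ^ m) := by
  obtain ⟨c, hc0, hc⟩ := D.exists_mem_wordBall_gensGbar
  obtain ⟨C, hC0, hC⟩ := D.exists_intProd_of_mem_wordBall_gensK
  have hc0' : (0 : ℝ) < c := by exact_mod_cast hc0
  refine ⟨C * c ^ (m ^ m), by positivity, fun r hr g hg => ?_⟩
  obtain ⟨g', hg', he⟩ := exists_map_eq_of_mem_wordBall K.subtype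
    (wordBall_mono D.gensGbar_subset_of_finite le_rfl (hc r g hg))
  obtain rfl : g' = g := Subtype.ext he
  obtain ⟨z, hz, hb⟩ := hC (c * r) (by positivity) _ hg'
  exact ⟨z, hz, fun i => (hb i).trans_eq (by rw [mul_pow, mul_assoc])⟩

end Generators

/-! ### Polynomial functions on a group. -/

section Poly

variable {G : Type*} [Group G]

/-- `f` is polynomial of degree `< c` on `H` with respect to right translations by `D`: the `c`-fold
differences of `f` with steps in `D` vanish on `H`. -/
def IsPoly (H D : Subgroup G) : ℕ → (G → ℝ) → Prop
  | 0, f => ∀ x ∈ H, f x = 0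
  | c + 1, f => ∀ d ∈ D, IsPoly H D c fun x => f (x * d) - f x

namespace IsPoly

variable {H D : Subgroup G}

theorem congr (hD : D ≤ H) {c : ℕ} {f g : G → ℝ} (hf : IsPoly H D c f)
    (hfg : ∀ x ∈ H, f x = g x) : IsPoly H D c g := by
  induction c generalizing f g with
  | zero => exact fun x hx => (hfg x hx).symm.trans (hf x hx)
  | succ c ih =>
    exact fun d hd => ih (hf d hd) fun x hx => by rw [hfg x hx, hfg _ (H.mul_mem hx (hD hd))]

theorem zero (c : ℕ) : IsPoly H D c fun _ => 0 := by
  induction c with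
  | zero => exact fun _ _ => rfl
  | succ c ih => exact fun d _ => by simpa using ih

theorem add {c : ℕ} {f g : G → ℝ} (hf : IsPoly H D c f) (hg : IsPoly H D c g) :
    IsPoly H D c fun x => f x + g x := by
  induction c generalizing f g with
  | zero => exact fun x hx => by simp only [hf x hx, hg x hx, add_zero]
  | succ c ih =>
    intro d hd
    convert ih (hf d hd) (hg d hd) using 2
    ring

theorem const_mul {c : ℕ} {f : G → ℝ} (hf : IsPoly H D c f) (a : ℝ) :
    IsPoly H D c fun x => a * f x := by
  induction c generalizing f with
  | zero => exact fun x hx => by simp only [hf x hx, mul_zero]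
  | succ c ih =>
    intro d hd
    convert ih (hf d hd) using 2
    ring

theorem sub {c : ℕ} {f g : G → ℝ} (hf : IsPoly H D c f) (hg : IsPoly H D c g) :
    IsPoly H D c fun x => f x - g x := by
  convert hf.add (hg.const_mul (-1)) using 2
  ring

theorem comp {G' : Type*} [Group G'] {H' D' : Subgroup G'} (φ : G' →* G) (hH : ∀ x ∈ H', φ x ∈ H)
    (hD : ∀ x ∈ D', φ x ∈ D) {c : ℕ} {f : G → ℝ} (hf : IsPoly H D c f) :
    IsPoly H' D' c fun x => f (φ x) := by
  induction c generalizing f with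
  | zero => exact fun x hx => hf _ (hH x hx)
  | succ c ih =>
    intro d hd
    simpa using ih (hf _ (hD d hd))

/-- The `d`-difference of the translate by `g` is the translate of the `g⁻¹ * d * g`-difference. -/
theorem translate (hD : ∀ g ∈ H, ∀ d ∈ D, g⁻¹ * d * g ∈ D) {c : ℕ} {f : G → ℝ}
    (hf : IsPoly H D c f) {g : G} (hg : g ∈ H) : IsPoly H D c fun x => f (x * g) := by
  induction c generalizing f with
  | zero => exact fun x hx => hf _ (H.mul_mem hx hg)
  | succ c ih =>
    intro d hd
    convert ih (hf _ (hD g hg d hd)) using 4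
    group

theorem translate_top {c : ℕ} {f : G → ℝ} (hf : IsPoly ⊤ ⊤ c f) (g : G) :
    IsPoly ⊤ ⊤ c fun x => f (x * g) :=
  translate (fun _ _ _ _ => Subgroup.mem_top _) hf (Subgroup.mem_top g)

end IsPoly

variable (G) in
/-- The space of polynomial functions of degree `< c` on a group. -/
def polySpace (c : ℕ) : Submodule ℝ (G → ℝ) where
  carrier := {f | IsPoly ⊤ ⊤ c f}
  add_mem' hf hg := hf.add hg
  zero_mem' := IsPoly.zero c
  smul_mem' a _ hf := hf.const_mul a

/-- By induction on the degree the `x`-difference of `f` is itself invariant under `x`. So `f (y * x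
^ n)` is affine in `n`, and equal values at `0` and `q` force slope zero. -/
theorem IsPoly.mul_eq_of_mul_pow_eq {c : ℕ} {f : G → ℝ} (hf : IsPoly ⊤ ⊤ c f) {x : G} {q : ℕ}
    (hq : 0 < q) (h : ∀ y, f (y * x ^ q) = f y) (y : G) : f (y * x) = f y := by
  induction c generalizing f y with
  | zero => rw [hf _ trivial, hf _ trivial]
  | succ c ih =>
    have h1 := ih (hf x trivial) fun y => by
      rw [h y, mul_assoc, ← pow_succ, pow_succ', ← mul_assoc, h]
    have h2 : ∀ n : ℕ, f (y * x ^ n * x) - f (y * x ^ n) = f (y * x) - f y := fun n => by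
      induction n with
      | zero => simp
      | succ n ihn => rw [pow_succ, ← mul_assoc, h1, ihn]
    have h3 : ∀ n : ℕ, f (y * x ^ n) = f y + n * (f (y * x) - f y) := fun n => by
      induction n with
      | zero => simp
      | succ n ihn =>
        have := h2 n
        rw [pow_succ, ← mul_assoc]
        push_cast
        linarith
    have h4 := h3 q
    rw [h y] at h4
    have : (q : ℝ) * (f (y * x) - f y) = 0 := by linarith
    rcases mul_eq_zero.1 this with h | h
    · exact absurd h (by exact_mod_cast hq.ne')
    · linarith

/-- The polynomial functions of bounded degree form a finite-dimensional space if some power of every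
element lies in a fixed finitely generated subgroup. -/
theorem finiteDimensional_polySpace {m : ℕ} (k : Fin m → G)
    (hk : ∀ x : G, ∃ q : ℕ, 0 < q ∧ x ^ q ∈ Subgroup.closure (Set.range k)) (c : ℕ) :
    FiniteDimensional ℝ (polySpace G c) := by
  induction c with
  | zero =>
    have : polySpace G 0 = ⊥ := by
      rw [eq_bot_iff]
      exact fun f hf => funext fun x => hf x trivial
    rw [this]
    infer_instance
  | succ c ih =>
    -- The value at `1` and the differences along the generators determine `f`: if they vanish, `f`
    -- is invariant under the closure, hence under roots of its elements, hence constant.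
    let Φ : polySpace G (c + 1) →ₗ[ℝ] ℝ × (Fin m → polySpace G c) :=
      { toFun := fun f => (f.1 1, fun i => ⟨fun x => f.1 (x * k i) - f.1 x, f.2 (k i) trivial⟩)
        map_add' := fun f g => by
          ext
          · simp
          · simp; ring
        map_smul' := fun a f => by
          ext
          · simp
          · simp; ring }
    refine Module.Finite.of_injective Φ ((injective_iff_map_eq_zero Φ).2 fun f hf => ?_)
    have h1 : f.1 1 = 0 := congrArg Prod.fst hf
    have h2 : ∀ i x, f.1 (x * k i) = f.1 x := fun i x =>
      sub_eq_zero.1 (congrFun (congrArg Subtype.val (congrFun (congrArg Prod.snd hf) i)) x)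
    have h3 : ∀ t ∈ Subgroup.closure (Set.range k), ∀ x, f.1 (x * t) = f.1 x := by
      intro t ht
      induction ht using Subgroup.closure_induction with
      | mem t ht => obtain ⟨i, rfl⟩ := ht; exact h2 i
      | one => simp
      | mul s t _ _ hs ht => intro x; rw [← mul_assoc, ht, hs]
      | inv t _ ht => intro x; rw [← ht (x * t⁻¹), inv_mul_cancel_right]
    ext x
    obtain ⟨q, hq, hx⟩ := hk x
    have := IsPoly.mul_eq_of_mul_pow_eq f.2 hq (h3 _ hx) 1
    rw [one_mul, h1] at this
    simpa using this

/-- A finite-dimensional space has a subadditive size function for which all linear operators and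
functionals are bounded. -/
theorem exists_size (V : Type*) [AddCommGroup V] [Module ℝ V] [FiniteDimensional ℝ V] :
    ∃ p : V → ℝ, (∀ f, 0 ≤ p f) ∧ p 0 = 0 ∧ (∀ f g, p (f + g) ≤ p f + p g) ∧
      (∀ T : V →ₗ[ℝ] V, ∃ C : ℝ, 1 ≤ C ∧ ∀ f, p (T f) ≤ C * p f) ∧
      ∀ T : V →ₗ[ℝ] ℝ, ∃ C : ℝ, 1 ≤ C ∧ ∀ f, |T f| ≤ C * p f := by
  let b := Module.finBasis ℝ V
  let p : V → ℝ := fun f => ∑ i, |b.repr f i|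
  have hp0 : ∀ f, 0 ≤ p f := fun f => Finset.sum_nonneg fun _ _ => abs_nonneg _
  have hadd : ∀ f g, p (f + g) ≤ p f + p g := fun f g => by
    simp only [p, map_add, Finsupp.add_apply, ← Finset.sum_add_distrib]
    exact Finset.sum_le_sum fun _ _ => abs_add_le _ _
  have hT : ∀ T : V →ₗ[ℝ] ℝ, ∃ C : ℝ, 1 ≤ C ∧ ∀ f, |T f| ≤ C * p f := fun T => by
    refine ⟨1 + ∑ i, |T (b i)|, by
      have := Finset.sum_nonneg (s := Finset.univ) fun i _ => abs_nonneg (T (b i))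
      linarith, fun f => ?_⟩
    conv_lhs => rw [← b.sum_repr f]
    rw [map_sum, Finset.mul_sum]
    refine (Finset.abs_sum_le_sum_abs _ _).trans (Finset.sum_le_sum fun i _ => ?_)
    rw [map_smul, smul_eq_mul, abs_mul, mul_comm]
    refine mul_le_mul_of_nonneg_right ?_ (abs_nonneg _)
    have := Finset.single_le_sum (f := fun i => |T (b i)|) (fun _ _ => abs_nonneg _)
      (Finset.mem_univ i)
    linarith
  refine ⟨p, hp0, by simp [p], hadd, fun T => ?_, hT⟩
  choose C hC1 hC using fun i => hT (b.coord i ∘ₗ T)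
  refine ⟨1 + ∑ i, C i, by
    have := Finset.sum_nonneg (s := Finset.univ) fun i _ => (zero_le_one.trans (hC1 i))
    linarith, fun f => ?_⟩
  calc p (T f) ≤ ∑ i, C i * p f := Finset.sum_le_sum fun i _ => hC i f
    _ = (∑ i, C i) * p f := by rw [Finset.sum_mul]
    _ ≤ _ := mul_le_mul_of_nonneg_right (by linarith) (hp0 f)

/-- Precomposition of polynomial functions with an endomorphism. -/
def polyComp (c : ℕ) (φ : G →* G) : polySpace G c →ₗ[ℝ] polySpace G c where
  toFun f := ⟨fun x => f.1 (φ x),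
    IsPoly.comp (H := ⊤) (D := ⊤) φ (fun _ _ => trivial) (fun _ _ => trivial) f.2⟩
  map_add' _ _ := rfl
  map_smul' _ _ := rfl

/-- The difference operator of a right translation on polynomial functions. -/
def polyDiff (c : ℕ) (g : G) : polySpace G c →ₗ[ℝ] polySpace G c where
  toFun f := ⟨fun x => f.1 (x * g) - f.1 x,
    IsPoly.sub (IsPoly.translate_top f.2 g) f.2⟩
  map_add' f h := by ext; simp; ring
  map_smul' a f := by ext; simp; ring

/-- Appending a letter `x` adds the translate of the `x`-difference of `f`, whose degree is one
less. The true degree `j` is tracked apart from the ambient `c`, so the bound is polynomial in the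
length rather than exponential. -/
theorem size_translate_list_prod_le {c : ℕ} {p : polySpace G c → ℝ} (hp0 : p 0 = 0)
    (hp : ∀ f, 0 ≤ p f) (hadd : ∀ f g, p (f + g) ≤ p f + p g) {B : ℝ} (hB : 0 ≤ B) (l : List G)
    (hl : ∀ x ∈ l, ∀ f, p (polyDiff c x f) ≤ B * p f) (j : ℕ) (f g : polySpace G c)
    (hf : IsPoly ⊤ ⊤ j f.1) (hg : ∀ x, g.1 x = f.1 (x * l.prod)) :
    p g ≤ (1 + l.length * B) ^ j * p f := by
  induction l using List.reverseRecOn generalizing j f g with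
  | nil =>
    obtain rfl : g = f := Subtype.ext (funext fun x => by simpa using hg x)
    simp
  | append_singleton l x ih =>
    cases j with
    | zero =>
      obtain rfl : f = 0 := Subtype.ext (funext fun x => hf x trivial)
      obtain rfl : g = 0 := Subtype.ext (funext fun x => by simpa using hg x)
      simp [hp0]
    | succ j =>
      have htr : ∀ f : polySpace G c, ∃ g : polySpace G c, ∀ x, g.1 x = f.1 (x * l.prod) :=
        fun f => ⟨⟨_, IsPoly.translate_top f.2 l.prod⟩,
          fun x => rfl⟩
      obtain ⟨g1, hg1⟩ := htr f
      obtain ⟨g2, hg2⟩ := htr (polyDiff c x f)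
      have e : g = g1 + g2 := Subtype.ext <| funext fun y => by
        rw [hg y, Submodule.coe_add, Pi.add_apply, hg1, hg2]
        simp [polyDiff, mul_assoc]
      have h1 := ih (fun y hy => hl y (List.mem_append_left _ hy)) (j + 1) f g1 hf hg1
      have h2 := ih (fun y hy => hl y (List.mem_append_left _ hy)) j (polyDiff c x f) g2
        (hf x trivial) hg2
      have h3 := hl x (by simp) f
      have h4 : (0 : ℝ) ≤ 1 + l.length * B := by positivity
      calc p g ≤ p g1 + p g2 := e ▸ hadd g1 g2
        _ ≤ (1 + l.length * B) ^ (j + 1) * p f + (1 + l.length * B) ^ j * (B * p f) :=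
          add_le_add h1 (h2.trans (mul_le_mul_of_nonneg_left h3 (by positivity)))
        _ = (1 + l.length * B) ^ j * (1 + (l.length + 1) * B) * p f := by ring
        _ ≤ (1 + (l.length + 1) * B) ^ j * (1 + (l.length + 1) * B) * p f := by
          have := hp f
          gcongr
          linarith
        _ = _ := by push_cast [List.length_append, List.length_singleton]; ring

end Poly

/-! ### Growth of polynomial functions along products of conjugates. -/

section Growth

variable {G : Type*} [Group G] {K : Subgroup G} [K.Normal]

/-- The elements of `K` which are conjugates of elements of `X` by words of length at most `n`. -/
def conjBall (K : Subgroup G) (Y X : Set G) (n : ℝ) : Set K :=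
  {x | ∃ w ∈ wordBall Y n, ∃ y ∈ X, (x : G) = w * y * w⁻¹}

/-- The difference operator of a conjugate `w * y * w⁻¹` is that of `y` conjugated by the action of
`w`, so its norm exceeds that of `y` by at most `A ^ n * A ^ n`. -/
theorem exists_abs_le_of_mem_wordBall_conjBall {c : ℕ} [FiniteDimensional ℝ (polySpace K c)]
    {Y X : Set G} (hY : Y.Finite) (hX : X.Finite) {f : K → ℝ} (hf : IsPoly ⊤ ⊤ c f) :
    ∃ A : ℝ, 1 ≤ A ∧ ∀ n N : ℕ, ∀ g ∈ wordBall (conjBall K Y X n) N,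
      |f g| ≤ A * (1 + N * (A * (A ^ n * A ^ n))) ^ c := by
  obtain ⟨p, hp, hp0, hadd, hT, hL⟩ := exists_size (polySpace K c)
  -- a bound for the operators of finitely many elements
  have hfin : ∀ (s : Set G), s.Finite → ∀ T : G → (polySpace K c →ₗ[ℝ] polySpace K c),
      ∃ C : ℝ, 1 ≤ C ∧ ∀ y ∈ s, ∀ f, p (T y f) ≤ C * p f := by
    intro s hs T
    choose C hC1 hC using fun y => hT (T y)
    obtain ⟨B, hB⟩ := (hs.image C).bddAbove
    refine ⟨max 1 B, le_max_left _ _, fun y hy f => (hC y f).trans ?_⟩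
    exact mul_le_mul_of_nonneg_right ((hB ⟨y, hy, rfl⟩).trans (le_max_right _ _)) (hp f)
  -- Precomposition with conjugation; a right action, whence the reversed order in `ha`.
  let a : G → (polySpace K c →ₗ[ℝ] polySpace K c) :=
    fun y => polyComp c (MulAut.conjNormal y : MulAut K).toMonoidHom
  have ha : ∀ y z f, a (y * z) f = a z (a y f) := fun y z f => by
    ext x
    simp [a, polyComp]
  obtain ⟨A, hA1, hA⟩ := hfin (Y ∪ Y⁻¹) (hY.union hY.inv) a
  have hA0 : (0 : ℝ) ≤ A := zero_le_one.trans hA1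
  classical
  obtain ⟨B, hB1, hB⟩ := hfin (X ∪ X⁻¹) (hX.union hX.inv)
    (fun y => if h : y ∈ K then polyDiff c ⟨y, h⟩ else 0)
  let ev : polySpace K c →ₗ[ℝ] ℝ :=
    { toFun := fun f => f.1 1, map_add' := fun _ _ => rfl, map_smul' := fun _ _ => rfl }
  obtain ⟨E, hE1, hE⟩ := hL ev
  have hword : ∀ (n : ℕ), ∀ w ∈ wordBall Y n, ∀ f, p (a w f) ≤ A ^ n * p f := by
    rintro n _ ⟨l, hl, hln, rfl⟩ f
    rw [Nat.cast_le] at hln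
    have : p (a l.prod f) ≤ A ^ l.length * p f := by
      clear hln
      induction l generalizing f with
      | nil =>
        have : a ([] : List G).prod f = f := by ext x; simp [a, polyComp]
        rw [this]
        simp
      | cons y l ih =>
        rw [List.prod_cons, ha, List.length_cons, pow_succ, mul_assoc]
        refine (ih (fun x hx => hl x (List.mem_cons_of_mem _ hx)) _).trans ?_
        refine mul_le_mul_of_nonneg_left (hA y ?_ f) (pow_nonneg hA0 _)
        exact (hl y List.mem_cons_self).imp id fun h => h
    exact this.trans (mul_le_mul_of_nonneg_right (pow_le_pow_right₀ hA1 hln) (hp f))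
  let A' := max (max A B) (E * p ⟨f, hf⟩)
  have hAA' : A ≤ A' := (le_max_left _ _).trans (le_max_left _ _)
  have hBA' : B ≤ A' := (le_max_right _ _).trans (le_max_left _ _)
  refine ⟨A', hA1.trans hAA', ?_⟩
  rintro n N _ ⟨l, hl, hlN, rfl⟩
  have hdiff : ∀ x ∈ l, ∀ f, p (polyDiff c x f) ≤ B * (A ^ n * A ^ n) * p f := by
    intro x hx f
    obtain ⟨w, hw, y, hy, hxy⟩ : ∃ w ∈ wordBall Y n, ∃ y ∈ X ∪ X⁻¹, (x : G) = w * y * w⁻¹ := by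
      rcases hl x hx with ⟨w, hw, y, hy, h⟩ | ⟨w, hw, y, hy, h⟩
      · exact ⟨w, hw, y, Or.inl hy, h⟩
      · refine ⟨w, hw, y⁻¹, Or.inr (by simpa using hy), ?_⟩
        rw [← inv_inj, ← Subgroup.coe_inv, h]
        group
    have hyK : y ∈ K := by
      have := (inferInstance : K.Normal).conj_mem _ x.2 w⁻¹
      rw [hxy] at this
      convert this using 1
      group
    have e : polyDiff c x f = a w⁻¹ (polyDiff c ⟨y, hyK⟩ (a w f)) := by
      ext z
      have e1 : (MulAut.conjNormal w : MulAut K)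
          ((MulAut.conjNormal w⁻¹ : MulAut K) z * ⟨y, hyK⟩) = z * x := by
        ext
        simp only [MulAut.conjNormal_apply, Subgroup.coe_mul, hxy]
        group
      have e2 : (MulAut.conjNormal w : MulAut K) ((MulAut.conjNormal w⁻¹ : MulAut K) z) = z := by
        ext
        simp only [MulAut.conjNormal_apply]
        group
      change f.1 (z * x) - f.1 z = f.1 ((MulAut.conjNormal w : MulAut K)
          ((MulAut.conjNormal w⁻¹ : MulAut K) z * ⟨y, hyK⟩)) -
        f.1 ((MulAut.conjNormal w : MulAut K) ((MulAut.conjNormal w⁻¹ : MulAut K) z))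
      rw [e1, e2]
    have h1 := hB y hy (a w f)
    rw [dif_pos hyK] at h1
    rw [e]
    calc _ ≤ A ^ n * p (polyDiff c ⟨y, hyK⟩ (a w f)) := hword n _ (inv_mem_wordBall hw) _
      _ ≤ A ^ n * (B * (A ^ n * p f)) := by
        refine mul_le_mul_of_nonneg_left (h1.trans ?_) (pow_nonneg hA0 _)
        exact mul_le_mul_of_nonneg_left (hword n w hw f) (zero_le_one.trans hB1)
      _ = _ := by ring
  have hB0 : (0 : ℝ) ≤ B := zero_le_one.trans hB1
  have hg := size_translate_list_prod_le hp0 hp hadd (by positivity) l hdiff c ⟨f, hf⟩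
    ⟨_, hf.translate_top l.prod⟩ hf (fun x => rfl)
  have h1 := hE ⟨_, hf.translate_top l.prod⟩
  have h2 : |f l.prod| = |ev ⟨_, hf.translate_top l.prod⟩| := by simp [ev]
  rw [h2]
  calc _ ≤ E * ((1 + l.length * (B * (A ^ n * A ^ n))) ^ c * p ⟨f, hf⟩) :=
        h1.trans (mul_le_mul_of_nonneg_left hg (zero_le_one.trans hE1))
    _ = (E * p ⟨f, hf⟩) * (1 + l.length * (B * (A ^ n * A ^ n))) ^ c := by ring
    _ ≤ A' * (1 + N * (A' * (A' ^ n * A' ^ n))) ^ c := by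
      have : E * p ⟨f, hf⟩ ≤ A' := le_max_right _ _
      have : (0 : ℝ) ≤ A' := hA0.trans hAA'
      gcongr

end Growth

/-! ### Conjugates of relators and commutators of words. -/

section Filling

variable {G : Type*} [Group G]

/-- The conjugates of elements of `X` by words in `Y` of length at most `n`. -/
def conjSet (Y X : Set G) (n : ℝ) : Set G := {x | ∃ w ∈ wordBall Y n, ∃ y ∈ X, x = w * y * w⁻¹}

theorem conjSet_mono (Y X : Set G) {n n' : ℝ} (h : n ≤ n') : conjSet Y X n ⊆ conjSet Y X n' := by
  rintro x ⟨w, hw, y, hy, rfl⟩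
  exact ⟨w, wordBall_mono le_rfl h hw, y, hy, rfl⟩

theorem conj_mem_wordBall_conjSet {Y X : Set G} {n N : ℝ} {g a : G}
    (hg : g ∈ wordBall (conjSet Y X n) N) (ha : a ∈ wordBall Y 1) :
    a * g * a⁻¹ ∈ wordBall (conjSet Y X (n + 1)) N := by
  refine map_mem_wordBall (MulAut.conj a).toMonoidHom ?_ hg
  rintro _ ⟨w, hw, y, hy, rfl⟩
  refine ⟨a * w, ?_, y, hy, by simp; group⟩
  rw [add_comm]
  exact mul_mem_wordBall ha hw

theorem mem_wordBall_one {Y : Set G} {a : G} (ha : a ∈ Y ∨ a⁻¹ ∈ Y) : a ∈ wordBall Y 1 :=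
  ⟨[a], by simpa using ha, by simp, by simp⟩

/-- Moving a letter past a word costs one conjugate of a commutator of letters for each letter of
the word. -/
theorem commutator_mem_wordBall_conjSet {Y X : Set G}
    (hX : ∀ a b, (a ∈ Y ∨ a⁻¹ ∈ Y) → (b ∈ Y ∨ b⁻¹ ∈ Y) → a * b * a⁻¹ * b⁻¹ ∈ X) {y : G}
    (hy : y ∈ Y ∨ y⁻¹ ∈ Y) (u : List G) (hu : ∀ x ∈ u, x ∈ Y ∨ x⁻¹ ∈ Y) :
    y * u.prod * y⁻¹ * u.prod⁻¹ ∈ wordBall (conjSet Y X u.length) u.length := by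
  induction u with
  | nil => simpa using one_mem_wordBall le_rfl
  | cons a u ih =>
    have ha := hu a List.mem_cons_self
    have h1 := conj_mem_wordBall_conjSet (ih fun x hx => hu x (List.mem_cons_of_mem _ hx))
      (mem_wordBall_one ha)
    have h2 : y * a * y⁻¹ * a⁻¹ ∈ conjSet Y X (u.length + 1) :=
      ⟨1, one_mem_wordBall (by positivity), _, hX y a hy ha, by simp⟩
    have h3 := mul_mem_wordBall (mem_wordBall_of_mem h2) h1
    have e : y * (a :: u).prod * y⁻¹ * (a :: u).prod⁻¹ =
        y * a * y⁻¹ * a⁻¹ * (a * (y * u.prod * y⁻¹ * u.prod⁻¹) * a⁻¹) := by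
      rw [List.prod_cons]; group
    rw [e, List.length_cons, Nat.cast_succ]
    rwa [add_comm 1] at h3

end Filling

/-! ### Quadratic filling over ℤ^n and exponential growth of polynomial functions. -/

namespace Generators

variable {G : Type*} [Group G] {K : Subgroup G} [K.Normal] {m n : ℕ} (D : Generators G K m n)

open Classical in
/-- The image in `ℤⁿ` of an element of `Ḡ`. -/
noncomputable def expVec (x : G) : Fin n → ℤ :=
  if h : x ∈ preimage K D.Z then Multiplicative.toAdd (D.e.symm ⟨QuotientGroup.mk' K x, h⟩) else 0

variable {D}

theorem expVec_of_mk_eq {x : G} {v : Fin n → ℤ}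
    (hx : (x : G ⧸ K) = (D.e (Multiplicative.ofAdd v) : G ⧸ K)) : D.expVec x = v := by
  have h : x ∈ preimage K D.Z := by
    change (x : G ⧸ K) ∈ D.Z
    rw [hx]
    exact SetLike.coe_mem _
  rw [expVec, dif_pos h]
  have : (⟨QuotientGroup.mk' K x, h⟩ : D.Z) = D.e (Multiplicative.ofAdd v) := Subtype.ext hx
  rw [this]
  simp

theorem mk_eq_of_mem {x : G} (hx : x ∈ preimage K D.Z) :
    (x : G ⧸ K) = (D.e (Multiplicative.ofAdd (D.expVec x)) : G ⧸ K) := by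
  rw [expVec, dif_pos hx]
  simp

theorem expVec_mul {x y : G} (hx : x ∈ preimage K D.Z) (hy : y ∈ preimage K D.Z) :
    D.expVec (x * y) = D.expVec x + D.expVec y := by
  apply expVec_of_mk_eq
  rw [QuotientGroup.mk_mul, mk_eq_of_mem hx, mk_eq_of_mem hy, ofAdd_add, map_mul,
    Subgroup.coe_mul]

theorem expVec_of_mem {x : G} (hx : x ∈ K) : D.expVec x = 0 := by
  apply expVec_of_mk_eq
  rw [(QuotientGroup.eq_one_iff x).2 hx]
  simp

theorem expVec_h (j : Fin n) : D.expVec (D.h j) = Pi.single j 1 := expVec_of_mk_eq (D.h_spec j)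

theorem gensGbar_subset : D.gensGbar ⊆ preimage K D.Z := by
  rw [← D.closure_eq]
  exact Subgroup.subset_closure

theorem letter_mem {y : G} (hy : y ∈ D.gensGbar ∨ y⁻¹ ∈ D.gensGbar) : y ∈ preimage K D.Z := by
  rcases hy with hy | hy
  · exact gensGbar_subset hy
  · exact (Subgroup.inv_mem_iff _).1 (gensGbar_subset hy)

theorem expVec_inv {x : G} (hx : x ∈ preimage K D.Z) : D.expVec x⁻¹ = -D.expVec x := by
  have h := expVec_mul hx (Subgroup.inv_mem _ hx)
  rw [mul_inv_cancel, expVec_of_mem K.one_mem] at h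
  exact (neg_eq_of_add_eq_zero_right h.symm).symm

theorem expVec_prod (j : Fin n) (l : List G) (hl : ∀ x ∈ l, x ∈ preimage K D.Z) :
    D.expVec l.prod j = (l.map fun x => D.expVec x j).sum := by
  induction l with
  | nil => simp [expVec_of_mem K.one_mem]
  | cons a l ih =>
    have hl' : ∀ x ∈ l, x ∈ preimage K D.Z := fun x hx => hl x (List.mem_cons_of_mem _ hx)
    rw [List.prod_cons, expVec_mul (hl a List.mem_cons_self) (Subgroup.list_prod_mem _ hl'),
      Pi.add_apply, ih hl', List.map_cons, List.sum_cons]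

theorem letter_cases {y : G} (hy : y ∈ D.gensGbar ∨ y⁻¹ ∈ D.gensGbar) :
    (y ∈ Set.range (fun i => ((D.k i : K) : G)) ∨ y⁻¹ ∈ Set.range (fun i => ((D.k i : K) : G))) ∨
      ∃ j, y = D.h j ∨ y = (D.h j)⁻¹ := by
  rcases hy with (hy | ⟨j, rfl⟩) | (hy | ⟨j, hj⟩)
  · exact Or.inl (Or.inl hy)
  · exact Or.inr ⟨j, Or.inl rfl⟩
  · exact Or.inl (Or.inr hy)
  · exact Or.inr ⟨j, Or.inr (by rw [hj, inv_inv])⟩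

theorem letter_mem_of_range {y : G} (hy : y ∈ Set.range (fun i => ((D.k i : K) : G)) ∨
    y⁻¹ ∈ Set.range (fun i => ((D.k i : K) : G))) : y ∈ K := by
  rcases hy with ⟨i, rfl⟩ | ⟨i, hi⟩
  · exact SetLike.coe_mem _
  · exact (Subgroup.inv_mem_iff _).1 (hi ▸ SetLike.coe_mem _)

theorem expVec_h_inv (j : Fin n) : D.expVec (D.h j)⁻¹ = -Pi.single j 1 := by
  rw [expVec_inv (gensGbar_subset (Or.inr ⟨j, rfl⟩)), expVec_h]

theorem eq_of_expVec_pos {y : G} (hy : y ∈ D.gensGbar ∨ y⁻¹ ∈ D.gensGbar) {j : Fin n}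
    (hj : 0 < D.expVec y j) : y = D.h j := by
  rcases letter_cases hy with hy | ⟨i, rfl | rfl⟩
  · simp [expVec_of_mem (letter_mem_of_range hy)] at hj
  · rw [expVec_h, Pi.single_apply] at hj
    split_ifs at hj with h
    · rw [h]
    · omega
  · rw [expVec_h_inv, Pi.neg_apply, Pi.single_apply] at hj
    split_ifs at hj <;> omega

theorem eq_of_expVec_neg {y : G} (hy : y ∈ D.gensGbar ∨ y⁻¹ ∈ D.gensGbar) {j : Fin n}
    (hj : D.expVec y j < 0) : y = (D.h j)⁻¹ := by
  rw [← inv_inv y, eq_of_expVec_pos (y := y⁻¹) (by rwa [inv_inv, or_comm])]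
  rw [expVec_inv (letter_mem hy), Pi.neg_apply]
  omega

variable (D) in
/-- The generators of `K̄` and the commutators of the generators of `Ḡ`. -/
def relators : Set G :=
  Set.range (fun i => ((D.k i : K) : G)) ∪
    (fun p : G × G => p.1 * p.2 * p.1⁻¹ * p.2⁻¹) ''
      ((D.gensGbar ∪ D.gensGbar⁻¹) ×ˢ (D.gensGbar ∪ D.gensGbar⁻¹))

theorem finite_relators : D.relators.Finite :=
  (Set.finite_range _).union (((D.finite_gensGbar.union D.finite_gensGbar.inv).prod
    (D.finite_gensGbar.union D.finite_gensGbar.inv)).image _)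

theorem commutator_mem_relators (a b : G) (ha : a ∈ D.gensGbar ∨ a⁻¹ ∈ D.gensGbar)
    (hb : b ∈ D.gensGbar ∨ b⁻¹ ∈ D.gensGbar) : a * b * a⁻¹ * b⁻¹ ∈ D.relators :=
  Or.inr ⟨(a, b), ⟨ha, hb⟩, rfl⟩

theorem relators_subset : D.relators ⊆ K := by
  rintro _ (⟨i, rfl⟩ | ⟨⟨a, b⟩, ⟨ha, hb⟩, rfl⟩)
  · exact SetLike.coe_mem _
  · have ha' := mk_eq_of_mem (letter_mem (D := D) ha)
    have hb' := mk_eq_of_mem (letter_mem (D := D) hb)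
    rw [SetLike.mem_coe, ← QuotientGroup.eq_one_iff]
    simp only [QuotientGroup.mk_mul, QuotientGroup.mk_inv, ha', hb']
    norm_cast
    rw [← map_mul, mul_comm, map_mul]
    group

theorem mem_of_mem_wordBall_conjSet {g : G} {a b : ℝ}
    (hg : g ∈ wordBall (conjSet D.gensGbar D.relators a) b) : g ∈ K := by
  obtain ⟨l, hl, -, rfl⟩ := hg
  have : ∀ x ∈ conjSet D.gensGbar D.relators a, x ∈ K := by
    rintro _ ⟨w, -, y, hy, rfl⟩
    exact (inferInstance : K.Normal).conj_mem _ (relators_subset hy) w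
  refine Subgroup.list_prod_mem _ fun x hx => ?_
  rcases hl x hx with h | h
  · exact this x h
  · exact (Subgroup.inv_mem_iff _).1 (this _ h)

/-- A word of length `N` in `K` is a product of at most `N ^ 2` conjugates of relators by words of
length at most `N`. -/
theorem list_prod_mem_wordBall_conjSet (N : ℕ) (l : List G)
    (hl : ∀ x ∈ l, x ∈ D.gensGbar ∨ x⁻¹ ∈ D.gensGbar) (hlN : l.length ≤ N) (hK : l.prod ∈ K) :
    l.prod ∈ wordBall (conjSet D.gensGbar D.relators N) ((N ^ 2 : ℕ) : ℝ) := by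
  induction N using Nat.strong_induction_on generalizing l with
  | _ N ih =>
  cases l with
  | nil => simpa using one_mem_wordBall (by positivity)
  | cons y l =>
    have hy := hl y List.mem_cons_self
    have hl' : ∀ x ∈ l, x ∈ D.gensGbar ∨ x⁻¹ ∈ D.gensGbar :=
      fun x hx => hl x (List.mem_cons_of_mem _ hx)
    rw [List.length_cons] at hlN
    rw [List.prod_cons] at hK ⊢
    have hmono : ∀ {a : ℕ}, a ≤ N → conjSet D.gensGbar D.relators a ⊆
        conjSet D.gensGbar D.relators N := fun h => conjSet_mono _ _ (by exact_mod_cast h)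
    by_cases hyK : y ∈ Set.range (fun i => ((D.k i : K) : G)) ∨
        y⁻¹ ∈ Set.range (fun i => ((D.k i : K) : G))
    · have h1 := ih (N - 1) (by omega) l hl' (by omega)
        ((Subgroup.mul_mem_cancel_left _ (letter_mem_of_range hyK)).1 hK)
      have hc : ∀ x ∈ Set.range (fun i => ((D.k i : K) : G)),
          x ∈ conjSet D.gensGbar D.relators N := fun x hx =>
        ⟨1, one_mem_wordBall (by positivity), x, Or.inl hx, by simp⟩
      have h2 := mem_wordBall_one (hyK.imp (hc _) (hc _))
      refine wordBall_mono le_rfl ?_ (mul_mem_wordBall h2 (wordBall_mono (hmono (by omega)) le_rfl h1))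
      norm_cast
      obtain ⟨M, rfl⟩ : ∃ M, N = M + 1 := ⟨N - 1, by omega⟩
      simp only [Nat.add_sub_cancel]
      nlinarith
    · obtain ⟨j, hj⟩ := (letter_cases hy).resolve_left hyK
      -- The exponent sum of `h j` vanishes on `K`, so some later letter cancels `y`; only the
      -- letter `y⁻¹` contributes with the opposite sign.
      have hinv : y⁻¹ ∈ l := by
        have hsum := expVec_of_mem (D := D) hK
        have hlp := fun x hx => letter_mem (hl' x hx)
        rw [expVec_mul (letter_mem hy) (Subgroup.list_prod_mem _ hlp)] at hsum
        have hsum := congrFun hsum j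
        rw [Pi.add_apply, expVec_prod j l hlp, Pi.zero_apply] at hsum
        by_contra hnot
        rcases hj with rfl | rfl
        · rw [expVec_h, Pi.single_eq_same] at hsum
          have : 0 ≤ (l.map fun x => D.expVec x j).sum := by
            refine List.sum_nonneg fun a ha => ?_
            obtain ⟨x, hx, rfl⟩ := List.mem_map.1 ha
            by_contra hneg
            exact hnot (eq_of_expVec_neg (hl' x hx) (not_le.1 hneg) ▸ hx)
          omega
        · rw [expVec_h_inv, Pi.neg_apply, Pi.single_eq_same] at hsum
          have : 0 ≤ (l.map fun x => -D.expVec x j).sum := by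
            refine List.sum_nonneg fun a ha => ?_
            obtain ⟨x, hx, rfl⟩ := List.mem_map.1 ha
            by_contra hneg
            refine hnot ?_
            rw [inv_inv]
            exact eq_of_expVec_pos (j := j) (hl' x hx) (by omega) ▸ hx
          have e : (l.map fun x => -D.expVec x j).sum = -(l.map fun x => D.expVec x j).sum := by
            clear * -
            induction l with
            | nil => simp
            | cons a l ih => simp only [List.map_cons, List.sum_cons, ih]; ring
          omega
      obtain ⟨u, v, rfl⟩ := List.append_of_mem hinv
      rw [List.length_append, List.length_cons] at hlN
      have hu : ∀ x ∈ u, x ∈ D.gensGbar ∨ x⁻¹ ∈ D.gensGbar :=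
        fun x hx => hl' x (List.mem_append_left _ hx)
      have hv : ∀ x ∈ v, x ∈ D.gensGbar ∨ x⁻¹ ∈ D.gensGbar :=
        fun x hx => hl' x (List.mem_append_right _ (List.mem_cons_of_mem _ hx))
      have h1 := commutator_mem_wordBall_conjSet commutator_mem_relators hy u hu
      -- Moving `y` up to `y⁻¹` costs a commutator filled by `u.length` conjugates, and the word
      -- shortens by two: `u.length + (N - 2) ^ 2` is at most `N ^ 2`.
      have e : y * (u ++ y⁻¹ :: v).prod =
          (y * u.prod * y⁻¹ * u.prod⁻¹) * (u ++ v).prod := by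
        simp only [List.prod_append, List.prod_cons]
        group
      rw [e] at hK ⊢
      have huv := (Subgroup.mul_mem_cancel_left _ (mem_of_mem_wordBall_conjSet h1)).1 hK
      have h2 := ih (N - 2) (by omega) (u ++ v)
        (fun x hx => (List.mem_append.1 hx).elim (hu x) (hv x))
        (by rw [List.length_append]; omega) huv
      refine wordBall_mono le_rfl ?_ (mul_mem_wordBall (wordBall_mono (hmono (by omega)) le_rfl h1)
        (wordBall_mono (hmono (by omega)) le_rfl h2))
      norm_cast
      obtain ⟨M, rfl⟩ : ∃ M, N = M + 2 := ⟨N - 2, by omega⟩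
      simp only [Nat.add_sub_cancel]
      nlinarith

theorem closure_range_k : Subgroup.closure (Set.range D.k) = ⊤ := by
  obtain ⟨S, κ, hS, h0, hκ⟩ := D.isMalcevBasis.exists_isCentralSeries
  rw [← h0, ← hS.closure_tail 0]
  apply le_antisymm
  · refine Subgroup.closure_mono ?_
    rintro _ ⟨i, rfl⟩
    exact ⟨i, Nat.zero_le _, hκ i⟩
  · rw [Subgroup.closure_le]
    rintro _ ⟨l, -, rfl⟩
    by_cases hl : l < m
    · exact Subgroup.subset_closure ⟨⟨l, hl⟩, (hκ ⟨l, hl⟩).symm⟩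
    · have := hS.mem l
      rw [hS.eq_bot l (by omega), Subgroup.mem_bot] at this
      rw [this]
      exact Subgroup.one_mem _

theorem finiteDimensional_polySpace (D : Generators G K m n) (c : ℕ) :
    FiniteDimensional ℝ (polySpace K c) := by
  refine MGroup.finiteDimensional_polySpace (fun i => (D.k i : K)) (fun x => ?_) c
  obtain ⟨q, hq, hx⟩ := D.exists_pow_mem x
  refine ⟨q, hq, ?_⟩
  have : Subgroup.closure (Set.range fun i => (D.k i : K)) = D.Kbar := by
    have e : (Set.range fun i => (D.k i : K)) = D.Kbar.subtype '' Set.range D.k := by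
      rw [← Set.range_comp]
      rfl
    rw [e, ← MonoidHom.map_closure, closure_range_k, ← MonoidHom.range_eq_map,
      Subgroup.range_subtype]
  rwa [this]

/-- Polynomial functions on `K` grow at most exponentially in the word length of `Ḡ`. -/
theorem exists_abs_le_rpow_of_isPoly (D : Generators G K m n) {c : ℕ} {f : K → ℝ}
    (hf : IsPoly ⊤ ⊤ c f) : ∃ C : ℝ, 1 ≤ C ∧ ∀ r : ℝ, 1 ≤ r → ∀ g : K,
      (g : G) ∈ wordBall D.gensGbar r → |f g| ≤ C ^ r := by
  have := D.finiteDimensional_polySpace c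
  obtain ⟨A, hA1, hA⟩ :=
    exists_abs_le_of_mem_wordBall_conjBall D.finite_gensGbar D.finite_relators hf
  have hA0 : (0 : ℝ) ≤ A := zero_le_one.trans hA1
  refine ⟨A * (8 * A ^ 3) ^ c, one_le_mul_of_one_le_of_one_le hA1 (one_le_pow₀ (by
    have := one_le_pow₀ (n := 3) hA1
    linarith)), fun r hr g hg => ?_⟩
  set N := ⌊r⌋₊ with hN
  have hN1 : 1 ≤ N := Nat.one_le_floor_iff r |>.2 hr
  obtain ⟨l, hl, hlr, hlg⟩ := hg
  have hlN : l.length ≤ N := Nat.le_floor hlr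
  have h1 := list_prod_mem_wordBall_conjSet N l hl hlN (by rw [hlg]; exact g.2)
  have hsub : conjSet D.gensGbar D.relators N ⊆
      K.subtype '' conjBall K D.gensGbar D.relators N := by
    rintro x ⟨w, hw, y, hy, rfl⟩
    exact ⟨⟨_, (inferInstance : K.Normal).conj_mem _ (relators_subset hy) w⟩,
      ⟨w, hw, y, hy, rfl⟩, rfl⟩
  obtain ⟨g', hg', he⟩ := exists_map_eq_of_mem_wordBall K.subtype (wordBall_mono hsub le_rfl h1)
  obtain rfl : g' = g := Subtype.ext (he.trans hlg)
  have h2 := hA N (N ^ 2) _ hg'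
  have hAN : 1 ≤ A ^ N := one_le_pow₀ hA1
  have h3 : ((N ^ 2 : ℕ) : ℝ) ≤ 4 ^ N := by
    have : N ^ 2 ≤ (2 ^ N) ^ 2 := Nat.pow_le_pow_left Nat.lt_two_pow_self.le 2
    rw [← pow_mul, mul_comm, pow_mul] at this
    exact_mod_cast this
  have h4 : A ≤ A ^ N := le_self_pow₀ hA1 (by omega)
  -- Of the base `8 * A ^ 3`, the factor 4 absorbs `N ^ 2`, the factor 2 absorbs the summand 1, and
  -- `A ^ 3` absorbs the three powers of `A`; `1 ≤ N` is needed.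
  have h5 : 1 + ((N ^ 2 : ℕ) : ℝ) * (A * (A ^ N * A ^ N)) ≤ (8 * A ^ 3) ^ N := by
    have e : (8 * A ^ 3 : ℝ) ^ N = 2 ^ N * (4 ^ N * (A ^ N * (A ^ N * A ^ N))) := by
      rw [mul_pow, ← pow_mul, mul_comm 3 N, pow_mul, show (8 : ℝ) = 2 * 4 by norm_num, mul_pow]
      ring
    have h6 : ((N ^ 2 : ℕ) : ℝ) * (A * (A ^ N * A ^ N)) ≤ 4 ^ N * (A ^ N * (A ^ N * A ^ N)) := by
      gcongr
    have h7 : (1 : ℝ) ≤ 4 ^ N * (A ^ N * (A ^ N * A ^ N)) :=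
      one_le_mul_of_one_le_of_one_le (one_le_pow₀ (by norm_num))
        (one_le_mul_of_one_le_of_one_le hAN (one_le_mul_of_one_le_of_one_le hAN hAN))
    have h8 : (2 : ℝ) ≤ 2 ^ N := le_self_pow₀ (by norm_num) (by omega)
    rw [e]
    nlinarith
  calc |f g'| ≤ A * (1 + ((N ^ 2 : ℕ) : ℝ) * (A * (A ^ N * A ^ N))) ^ c := h2
    _ ≤ A ^ N * ((8 * A ^ 3) ^ N) ^ c := by gcongr
    _ = (A * (8 * A ^ 3) ^ c) ^ N := by
      rw [mul_pow A, ← pow_mul, ← pow_mul, mul_comm N c]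
    _ = (A * (8 * A ^ 3) ^ c) ^ (N : ℝ) := (Real.rpow_natCast _ _).symm
    _ ≤ _ := Real.rpow_le_rpow_of_exponent_le
      (one_le_mul_of_one_le_of_one_le hA1 (one_le_pow₀ (by
        have := one_le_pow₀ (n := 3) hA1
        linarith))) (Nat.floor_le (by linarith))

end Generators

/-! ### Rational powers in a radicable group. -/

section RatPow

variable {N : Type*} [Group N] (hN : Radicable N)
include hN

theorem Radicable.eq_of_pow_eq {q : ℕ} (hq : 0 < q) {x y : N} (h : x ^ q = y ^ q) : x = y :=
  (hN q hq (y ^ q)).unique h rfl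

theorem ratPow_pow_den (x : N) (z : ℚ) : ratPow hN x z ^ z.den = x ^ z.num :=
  (hN z.den z.den_pos (x ^ z.num)).choose_spec.1

/-- Frees computations from lowest terms, so that two exponents can share a denominator. -/
theorem ratPow_pow_eq (x : N) {z : ℚ} {q : ℕ} {p : ℤ} (h : z * q = p) :
    ratPow hN x z ^ q = x ^ p := by
  apply hN.eq_of_pow_eq z.den_pos
  rw [← pow_mul, mul_comm, pow_mul, ratPow_pow_den, ← zpow_natCast, ← zpow_natCast, ← zpow_mul,
    ← zpow_mul]
  congr 1
  have hd : (z.den : ℚ) ≠ 0 := by exact_mod_cast z.den_ne_zero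
  have : (z.num : ℚ) * q = p * z.den := by
    rw [← h]
    nth_rewrite 2 [← Rat.num_div_den z]
    field_simp
  exact_mod_cast this

theorem commute_ratPow {x y : N} (h : Commute x y) (z : ℚ) : Commute (ratPow hN x z) y := by
  have : y * ratPow hN x z * y⁻¹ = ratPow hN x z := by
    apply hN.eq_of_pow_eq z.den_pos
    rw [conj_pow, ratPow_pow_den, ← (h.zpow_left z.num).eq, mul_inv_cancel_right]
  exact (mul_inv_eq_iff_eq_mul.1 this).symm

theorem ratPow_add (x : N) (a b : ℚ) : ratPow hN x (a + b) = ratPow hN x a * ratPow hN x b := by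
  have hc : Commute (ratPow hN x a) (ratPow hN x b) :=
    commute_ratPow hN (commute_ratPow hN (Commute.refl x) b).symm a
  have ha : (a.den : ℚ) ≠ 0 := by exact_mod_cast a.den_ne_zero
  have hb : (b.den : ℚ) ≠ 0 := by exact_mod_cast b.den_ne_zero
  have ha' : a * a.den = a.num := Rat.mul_den_eq_num a
  have hb' : b * b.den = b.num := Rat.mul_den_eq_num b
  apply hN.eq_of_pow_eq (Nat.mul_pos a.den_pos b.den_pos)
  rw [hc.mul_pow, ratPow_pow_eq hN x (z := a) (q := a.den * b.den) (p := a.num * b.den) (by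
      push_cast; rw [← ha']; ring),
    ratPow_pow_eq hN x (z := b) (q := a.den * b.den) (p := b.num * a.den) (by
      push_cast; rw [← hb']; ring),
    ratPow_pow_eq hN x (z := a + b) (q := a.den * b.den) (p := a.num * b.den + b.num * a.den) (by
      push_cast; rw [← hb', ← ha']; ring), zpow_add]

theorem ratPow_one_left (z : ℚ) : ratPow hN 1 z = 1 := by
  apply hN.eq_of_pow_eq z.den_pos
  rw [ratPow_pow_den, one_zpow, one_pow]

theorem ratPow_one (x : N) : ratPow hN x 1 = x := by
  simpa using ratPow_pow_eq hN x (z := 1) (q := 1) (p := 1) (by simp)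

/-- The rational powers of `x` as a homomorphism. -/
noncomputable def ratPowHom (x : N) : Multiplicative ℚ →* N :=
  MonoidHom.mk' (fun z => ratPow hN x z.toAdd) fun a b => ratPow_add hN x a.toAdd b.toAdd

theorem ratPow_zero (x : N) : ratPow hN x 0 = 1 := (ratPowHom hN x).map_one

theorem ratPow_neg (x : N) (z : ℚ) : ratPow hN x (-z) = (ratPow hN x z)⁻¹ :=
  (ratPowHom hN x).map_inv (Multiplicative.ofAdd z)

theorem ratPow_pow (x : N) (z : ℚ) (q : ℕ) : ratPow hN x z ^ q = ratPow hN x (q * z) := by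
  have := (ratPowHom hN x).map_pow (Multiplicative.ofAdd z) q
  rw [← ofAdd_nsmul, nsmul_eq_mul] at this
  exact this.symm

theorem ratPow_zpow (x : N) (z : ℚ) (q : ℤ) : ratPow hN x z ^ q = ratPow hN x (q * z) := by
  have := (ratPowHom hN x).map_zpow (Multiplicative.ofAdd z) q
  rw [← ofAdd_zsmul, zsmul_eq_mul] at this
  exact this.symm

end RatPow

/-! ### The central series of rational powers. -/

section RatSeries

variable {N : Type*} [Group N] (hN : Radicable N) {m : ℕ} {S : ℕ → Subgroup N} {κ : ℕ → N}

/-- The subgroup generated by the rational powers of `κ i, κ (i + 1), …`. -/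
def ratSeries (κ : ℕ → N) (i : ℕ) : Subgroup N :=
  Subgroup.closure {x | ∃ l, i ≤ l ∧ ∃ z, ratPow hN (κ l) z = x}

theorem ratPow_mem_ratSeries (i : ℕ) (z : ℚ) : ratPow hN (κ i) z ∈ ratSeries hN κ i :=
  Subgroup.subset_closure ⟨i, le_rfl, z, rfl⟩

theorem ratSeries_antitone : Antitone (ratSeries hN κ) := fun _ _ hij =>
  Subgroup.closure_mono fun _ ⟨l, hl, z, hz⟩ => ⟨l, hij.trans hl, z, hz⟩

theorem ratSeries_eq_sup (i : ℕ) :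
    ratSeries hN κ i = (ratPowHom hN (κ i)).range ⊔ ratSeries hN κ (i + 1) := by
  apply le_antisymm
  · rw [ratSeries, Subgroup.closure_le]
    rintro _ ⟨l, hl, z, rfl⟩
    rcases hl.eq_or_lt with rfl | hl
    · exact Subgroup.mem_sup_left ⟨Multiplicative.ofAdd z, rfl⟩
    · exact Subgroup.mem_sup_right (Subgroup.subset_closure ⟨l, hl, z, rfl⟩)
  · refine sup_le ?_ (ratSeries_antitone hN (Nat.le_succ i))
    rintro _ ⟨z, rfl⟩
    exact ratPow_mem_ratSeries hN i z.toAdd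

/-- Roots are unique modulo `A`. -/
def UniqueRootsMod (A : Subgroup N) : Prop :=
  ∀ (q : ℕ) (x y : N), 0 < q → (x ^ q)⁻¹ * y ^ q ∈ A → x⁻¹ * y ∈ A

theorem UniqueRootsMod.eq {A : Subgroup N} [A.Normal] (h : UniqueRootsMod A) {q : ℕ} (hq : 0 < q)
    {x y : N ⧸ A} (hxy : x ^ q = y ^ q) : x = y := by
  obtain ⟨x, rfl⟩ := QuotientGroup.mk_surjective x
  obtain ⟨y, rfl⟩ := QuotientGroup.mk_surjective y
  exact QuotientGroup.eq.2 (h q x y hq (QuotientGroup.eq.1 (by simpa using hxy)))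

/-- With unique roots in the quotient, commuting with a positive power of an element implies
commuting with the element. This is used for a power of `y` in `S 0`, for `y`, and for the root
defining the rational power. -/
theorem IsCentralSeries.commute_mk_ratPow (h : IsCentralSeries m S κ)
    (hcov : ∀ x : N, ∃ q : ℕ, 0 < q ∧ x ^ q ∈ S 0) {i : ℕ} {A : Subgroup N} [A.Normal]
    (hA : UniqueRootsMod A) (hS : S (i + 1) ≤ A) (z : ℚ) (y : N ⧸ A) :
    Commute ((ratPow hN (κ i) z : N) : N ⧸ A) y := by
  have hconj : ∀ (q : ℕ), 0 < q → ∀ x y : N ⧸ A, Commute x (y ^ q) → Commute x y := by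
    intro q hq x y hxy
    have : x * y * x⁻¹ = y := hA.eq hq (by rw [conj_pow, hxy.eq, mul_inv_cancel_right])
    exact mul_inv_eq_iff_eq_mul.1 this
  refine (hconj _ z.den_pos _ _ ?_).symm
  rw [← QuotientGroup.mk_pow, ratPow_pow_den, QuotientGroup.mk_zpow]
  refine Commute.zpow_right (Commute.symm ?_) _
  obtain ⟨y, rfl⟩ := QuotientGroup.mk_surjective y
  obtain ⟨q, hq, hy⟩ := hcov y
  refine hconj q hq _ _ ?_
  have h1 : ((κ i * y ^ q * (κ i)⁻¹ * (y ^ q)⁻¹ : N) : N ⧸ A) = 1 :=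
    (QuotientGroup.eq_one_iff _).2 (hS (h.comm i _ (h.mem i) _ hy))
  simp only [QuotientGroup.mk_mul, QuotientGroup.mk_inv, QuotientGroup.mk_pow] at h1
  exact mul_inv_eq_iff_eq_mul.1 (mul_inv_eq_one.1 h1)

theorem exists_ratPow_mul_of_mem_ratSeries {i : ℕ} [(ratSeries hN κ (i + 1)).Normal] {x : N}
    (hx : x ∈ ratSeries hN κ i) :
    ∃ z : ℚ, (x : N ⧸ ratSeries hN κ (i + 1)) = ((ratPow hN (κ i) z : N) : N ⧸ ratSeries hN κ (i + 1)) := by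
  rw [ratSeries_eq_sup, Subgroup.mem_sup_of_normal_right] at hx
  obtain ⟨_, ⟨z, rfl⟩, s, hs, rfl⟩ := hx
  exact ⟨z.toAdd, (QuotientGroup.mk_mul_of_mem _ hs)⟩

theorem IsCentralSeries.comm_ratSeries_aux (h : IsCentralSeries m S κ)
    (hcov : ∀ x : N, ∃ q : ℕ, 0 < q ∧ x ^ q ∈ S 0) {i : ℕ} [(ratSeries hN κ (i + 1)).Normal]
    (hA : UniqueRootsMod (ratSeries hN κ (i + 1))) (hS : S (i + 1) ≤ ratSeries hN κ (i + 1))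
    {x : N} (hx : x ∈ ratSeries hN κ i) (y : N) : x * y * x⁻¹ * y⁻¹ ∈ ratSeries hN κ (i + 1) := by
  obtain ⟨z, hz⟩ := exists_ratPow_mul_of_mem_ratSeries hN hx
  rw [← QuotientGroup.eq_one_iff]
  simp only [QuotientGroup.mk_mul, QuotientGroup.mk_inv, hz]
  rw [(h.commute_mk_ratPow hN hcov hA hS z y).eq, mul_inv_cancel_right, mul_inv_cancel]

/-- The three properties are proved together, descending from the trivial term: unique roots one
level down make `κ i` and its rational powers central there, which gives normality and unique roots
at level `i`. -/
theorem IsCentralSeries.ratSeries_aux (h : IsCentralSeries m S κ)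
    (hcov : ∀ x : N, ∃ q : ℕ, 0 < q ∧ x ^ q ∈ S 0) (d : ℕ) : ∀ i, m ≤ i + d →
      (ratSeries hN κ i).Normal ∧ UniqueRootsMod (ratSeries hN κ i) ∧ S i ≤ ratSeries hN κ i := by
  induction d with
  | zero =>
    intro i hi
    have : ratSeries hN κ i = ⊥ := by
      rw [ratSeries, Subgroup.closure_eq_bot_iff]
      rintro _ ⟨l, hl, z, rfl⟩
      have := h.mem l
      rw [h.eq_bot l (by omega), Subgroup.mem_bot] at this
      rw [this, ratPow_one_left]
      rfl
    rw [this, h.eq_bot i (by omega)]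
    refine ⟨inferInstance, fun q x y hq hxy => ?_, le_rfl⟩
    rw [Subgroup.mem_bot, inv_mul_eq_one] at hxy ⊢
    exact hN.eq_of_pow_eq hq hxy
  | succ d ih =>
    intro i hi
    obtain ⟨hn, hA, hS⟩ := ih (i + 1) (by omega)
    have hcomm := fun x (hx : x ∈ ratSeries hN κ i) y => h.comm_ratSeries_aux hN hcov hA hS hx y
    have hle := ratSeries_antitone hN (κ := κ) (Nat.le_succ i)
    refine ⟨⟨fun x hx y => ?_⟩, fun q x y hq hxy => ?_, ?_⟩
    · have := Subgroup.mul_mem _ (Subgroup.inv_mem _ (hle (hcomm x hx y))) hx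
      convert this using 1
      group
    · obtain ⟨z, hz⟩ := exists_ratPow_mul_of_mem_ratSeries hN hxy
      have hq' : (q : ℚ) ≠ 0 := by exact_mod_cast hq.ne'
      have e : ratPow hN (κ i) z = ratPow hN (κ i) (z / q) ^ q := by
        rw [ratPow_pow, mul_div_cancel₀ _ hq']
      have hc := h.commute_mk_ratPow hN hcov hA hS (z / q) (x : N ⧸ ratSeries hN κ (i + 1))
      -- Since the rational power is central in the quotient, the right side is a `q`-th root of the
      -- image of `y ^ q`.
      have h1 : (y : N ⧸ ratSeries hN κ (i + 1)) =
          x * (ratPow hN (κ i) (z / q) : N) := by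
        refine hA.eq hq ?_
        rw [hc.symm.mul_pow, ← QuotientGroup.mk_pow (ratSeries hN κ (i + 1)) (ratPow hN (κ i) (z / q)), ← e, ← hz]
        simp
      have h2 : ((x⁻¹ * y : N) : N ⧸ ratSeries hN κ (i + 1)) = (ratPow hN (κ i) (z / q) : N) := by
        rw [QuotientGroup.mk_mul, h1, QuotientGroup.mk_inv, inv_mul_cancel_left]
      have h3 := hle (QuotientGroup.eq.1 h2.symm)
      have := Subgroup.mul_mem _ (ratPow_mem_ratSeries hN (κ := κ) i (z / q)) h3
      rwa [mul_inv_cancel_left] at this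
    · rw [← h.closure i, Subgroup.closure_le, Set.insert_subset_iff]
      refine ⟨?_, fun x hx => hle (hS hx)⟩
      have := ratPow_mem_ratSeries hN (κ := κ) i 1
      rwa [ratPow_one] at this

namespace IsCentralSeries

theorem normal_ratSeries (h : IsCentralSeries m S κ)
    (hcov : ∀ x : N, ∃ q : ℕ, 0 < q ∧ x ^ q ∈ S 0) (i : ℕ) : (ratSeries hN κ i).Normal :=
  (h.ratSeries_aux hN hcov m i (by omega)).1

theorem uniqueRootsMod_ratSeries (h : IsCentralSeries m S κ)
    (hcov : ∀ x : N, ∃ q : ℕ, 0 < q ∧ x ^ q ∈ S 0) (i : ℕ) :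
    UniqueRootsMod (ratSeries hN κ i) :=
  (h.ratSeries_aux hN hcov m i (by omega)).2.1

theorem le_ratSeries (h : IsCentralSeries m S κ)
    (hcov : ∀ x : N, ∃ q : ℕ, 0 < q ∧ x ^ q ∈ S 0) (i : ℕ) : S i ≤ ratSeries hN κ i :=
  (h.ratSeries_aux hN hcov m i (by omega)).2.2

theorem comm_ratSeries (h : IsCentralSeries m S κ)
    (hcov : ∀ x : N, ∃ q : ℕ, 0 < q ∧ x ^ q ∈ S 0) {i : ℕ} {x : N} (hx : x ∈ ratSeries hN κ i)
    (y : N) : x * y * x⁻¹ * y⁻¹ ∈ ratSeries hN κ (i + 1) :=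
  have := h.normal_ratSeries hN hcov (i + 1)
  h.comm_ratSeries_aux hN hcov (h.uniqueRootsMod_ratSeries hN hcov _) (h.le_ratSeries hN hcov _)
    hx y

theorem ratSeries_eq_bot (h : IsCentralSeries m S κ) : ratSeries hN κ m = ⊥ := by
  rw [ratSeries, Subgroup.closure_eq_bot_iff]
  rintro _ ⟨l, hl, z, rfl⟩
  have := h.mem l
  rw [h.eq_bot l (by omega), Subgroup.mem_bot] at this
  rw [this, ratPow_one_left]
  rfl

theorem ratSeries_zero (h : IsCentralSeries m S κ)
    (hcov : ∀ x : N, ∃ q : ℕ, 0 < q ∧ x ^ q ∈ S 0) : ratSeries hN κ 0 = ⊤ := by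
  refine eq_top_iff.2 fun x _ => ?_
  obtain ⟨q, hq, hx⟩ := hcov x
  simpa using h.uniqueRootsMod_ratSeries hN hcov 0 q 1 x hq
    (by simpa using h.le_ratSeries hN hcov 0 hx)

/-- The exponent of `κ i` as a homomorphism on `ratSeries hN κ i`. -/
theorem exists_exponent (h : IsCentralSeries m S κ)
    (hcov : ∀ x : N, ∃ q : ℕ, 0 < q ∧ x ^ q ∈ S 0) (i : ℕ) : ∃ ζ : N → ℚ,
      (∀ x ∈ ratSeries hN κ i, ∀ y ∈ ratSeries hN κ i, ζ (x * y) = ζ x + ζ y) ∧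
      (∀ x ∈ ratSeries hN κ (i + 1), ζ x = 0) ∧
      ∀ x ∈ ratSeries hN κ i, (ratPow hN (κ i) (ζ x))⁻¹ * x ∈ ratSeries hN κ (i + 1) := by
  have hn := h.normal_ratSeries hN hcov (i + 1)
  have hA := h.uniqueRootsMod_ratSeries hN hcov (i + 1)
  -- If one non-trivial exponent lands in the next term, unique roots put all rational powers there,
  -- and the zero exponent works. This includes `κ i = 1`, as for `i ≥ m`.
  by_cases hinj : ∀ z, ratPow hN (κ i) z ∈ ratSeries hN κ (i + 1) → z = 0
  · have huniq : ∀ a b, ((ratPow hN (κ i) a : N) : N ⧸ ratSeries hN κ (i + 1)) =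
        ((ratPow hN (κ i) b : N) : N ⧸ ratSeries hN κ (i + 1)) → a = b := fun a b hab => by
      have := QuotientGroup.eq.1 hab
      rw [← ratPow_neg, ← ratPow_add] at this
      linarith [hinj _ this]
    have hex : ∀ x : N, ∃ z : ℚ, x ∈ ratSeries hN κ i →
        (x : N ⧸ ratSeries hN κ (i + 1)) = ((ratPow hN (κ i) z : N) : N ⧸ ratSeries hN κ (i + 1)) :=
      fun x => by
        by_cases hx : x ∈ ratSeries hN κ i
        · obtain ⟨z, hz⟩ := exists_ratPow_mul_of_mem_ratSeries hN hx
          exact ⟨z, fun _ => hz⟩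
        · exact ⟨0, fun h => absurd h hx⟩
    choose ζ hζ using hex
    refine ⟨ζ, fun x hx y hy => huniq _ _ ?_, fun x hx => huniq _ _ ?_, fun x hx => ?_⟩
    · rw [← hζ _ (Subgroup.mul_mem _ hx hy), ratPow_add, QuotientGroup.mk_mul,
        QuotientGroup.mk_mul, hζ x hx, hζ y hy]
    · rw [← hζ _ (ratSeries_antitone hN (Nat.le_succ i) hx), ratPow_zero, QuotientGroup.mk_one,
        QuotientGroup.eq_one_iff]
      exact hx
    · exact QuotientGroup.eq.1 (hζ x hx).symm
  · push Not at hinj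
    obtain ⟨a, ha, ha0⟩ := hinj
    have hall : ∀ z, ratPow hN (κ i) z ∈ ratSeries hN κ (i + 1) := fun z => by
      have hd := (z / a).den_pos
      have e : ratPow hN (κ i) z ^ (z / a).den = ratPow hN (κ i) a ^ (z / a).num := by
        rw [ratPow_pow, ratPow_zpow]
        congr 1
        rw [← Rat.mul_den_eq_num (z / a)]
        field_simp
      have := hA _ 1 (ratPow hN (κ i) z) hd (by
        rw [e, one_pow, inv_one, one_mul]
        exact Subgroup.zpow_mem _ ha _)
      simpa using this
    refine ⟨fun _ => 0, fun _ _ _ _ => by simp, fun _ _ => rfl, fun x hx => ?_⟩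
    obtain ⟨z, hz⟩ := exists_ratPow_mul_of_mem_ratSeries hN hx
    have h1 := QuotientGroup.eq.1 hz.symm
    have h2 := Subgroup.mul_mem _ (hall z) h1
    simpa [ratPow_zero] using h2

end IsCentralSeries

end RatSeries

/-! ### Extending polynomiality from a subgroup to the whole group. -/

section Extension

variable {N : Type*} [Group N] {H : Subgroup N} {A : ℕ → Subgroup N} {T : Set N}

/-- Functions on `H` which are invariant under `T` on the left and `A j` on the right and are
polynomial of degree `< c` with respect to right translations by `A 0`. -/
def IsExtendedPoly (H : Subgroup N) (A : ℕ → Subgroup N) (T : Set N) (j c : ℕ) (f : N → ℝ) :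
    Prop :=
  (∀ t ∈ T, ∀ x ∈ H, f (t * x) = f x) ∧ (∀ x ∈ H, ∀ s ∈ A j, f (x * s) = f x) ∧ IsPoly H (A 0) c f

theorem IsExtendedPoly.diff {j c : ℕ} {f : N → ℝ} (hA : ∀ j, (A j).Normal)
    (hf : IsExtendedPoly H A T j c f) {g : N} (hg : g ∈ H) :
    IsExtendedPoly H A T j c fun x => f (x * g) - f x := by
  obtain ⟨h1, h2, h3⟩ := hf
  refine ⟨fun t ht x hx => ?_, fun x hx s hs => ?_, ?_⟩
  · simp only [mul_assoc, h1 t ht _ (H.mul_mem hx hg), h1 t ht x hx]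
  · have e : x * s * g = x * g * (g⁻¹ * s * g) := by group
    have := (hA j).conj_mem s hs g⁻¹
    rw [inv_inv] at this
    simp only [e, h2 _ (H.mul_mem hx hg) _ this, h2 x hx s hs]
  · refine IsPoly.sub (IsPoly.translate (fun g _ d hd => ?_) h3 hg) h3
    simpa using (hA 0).conj_mem d hd g⁻¹

/-- For `j = 0` the two invariances make `f` constant on `H`. Otherwise differences along `A j`
lower `c`, while a function killed by all of them is `A j`-invariant, which lowers `j`. -/
theorem IsExtendedPoly.exists_isPoly (hA : ∀ j, (A j).Normal) (hanti : Antitone A) (hAH : A 0 ≤ H)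
    (hcomm : ∀ j, ∀ x ∈ A j, ∀ y ∈ H, x * y * x⁻¹ * y⁻¹ ∈ A (j + 1))
    (hT : ∀ x ∈ H, ∃ t ∈ T, t⁻¹ * x ∈ A 0) (j c : ℕ) :
    ∃ C, ∀ f, IsExtendedPoly H A T j c f → IsPoly H H C f := by
  induction j generalizing c with
  | zero =>
    refine ⟨1, fun f hf g hg x hx => ?_⟩
    have hconst : ∀ x ∈ H, f x = f 1 := fun x hx => by
      obtain ⟨t, ht, hs⟩ := hT x hx
      have h1 := hf.1 t ht _ (hAH hs)
      rw [mul_inv_cancel_left] at h1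
      rw [h1]
      simpa using hf.2.1 1 H.one_mem _ hs
    simp only [hconst x hx, hconst _ (H.mul_mem hx hg), sub_self]
  | succ j ihj =>
    induction c with
    | zero => exact ⟨0, fun f hf => hf.2.2⟩
    | succ c ihc =>
      obtain ⟨C₁, hC₁⟩ := ihc
      obtain ⟨C₂, hC₂⟩ := ihj (c + 1)
      -- Induction on the degree of the `A j`-differences. Differences along `t ∈ A j` and `g ∈ H`
      -- commute on `f`, because the commutator lies in `A (j + 1)`, under which `f` is invariant.
      have key : ∀ C f, IsExtendedPoly H A T (j + 1) (c + 1) f →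
          (∀ t ∈ A j, IsPoly H H C fun x => f (x * t) - f x) → IsPoly H H (C + C₂) f := by
        intro C
        induction C with
        | zero =>
          intro f hf h
          rw [Nat.zero_add]
          exact hC₂ f ⟨hf.1, fun x hx s hs => sub_eq_zero.1 (h s hs x hx), hf.2.2⟩
        | succ C ih =>
          intro f hf h
          rw [Nat.succ_add]
          refine fun g hg => ih _ (hf.diff hA hg) fun t ht => ?_
          refine (h t ht g hg).congr le_rfl fun x hx => ?_
          have htH : t ∈ H := hAH (hanti (Nat.zero_le j) ht)
          have e : x * g * t = x * t * g * (t⁻¹ * g⁻¹ * t⁻¹⁻¹ * g⁻¹⁻¹)⁻¹ := by group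
          have := hcomm j _ ((A j).inv_mem ht) _ (H.inv_mem hg)
          beta_reduce
          rw [e, hf.2.1 _ (H.mul_mem (H.mul_mem hx htH) hg) _ ((A (j + 1)).inv_mem this)]
          ring
      refine ⟨C₁ + C₂, fun f hf => key C₁ f hf fun t ht => hC₁ _ ?_⟩
      have ht0 := hanti (Nat.zero_le j) ht
      have := hf.diff hA (hAH ht0)
      exact ⟨this.1, this.2.1, hf.2.2 t ht0⟩

/-- Since `τ` commutes with right translations by `B`, differences along `B` pass through it. Other
directions are left to `IsExtendedPoly.exists_isPoly`. -/
theorem IsPoly.comp_retraction {B : Subgroup N} (hBH : B ≤ H) {τ : N → N}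
    (hτ : ∀ x ∈ H, τ x ∈ B) (hτm : ∀ x ∈ H, ∀ s ∈ B, τ (x * s) = τ x * s) {c : ℕ} {f : N → ℝ}
    (hf : IsPoly B B c f) : IsPoly H B c fun x => f (τ x) := by
  induction c generalizing f with
  | zero => exact fun x hx => hf _ (hτ x hx)
  | succ c ih =>
    exact fun s hs => (ih (hf s hs)).congr hBH fun x hx => by simp only [hτm x hx s hs]

end Extension

/-! ### Polynomial coordinates on the completion. -/

section Coordinates

variable {N : Type*} [Group N] (hN : Radicable N) {m : ℕ} {S : ℕ → Subgroup N} {κ : ℕ → N}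

/-- A polynomial function of the component of `x` in `ratSeries hN κ (i + 1)` is polynomial in
`x`. -/
theorem IsCentralSeries.exists_isPoly_comp (h : IsCentralSeries m S κ)
    (hcov : ∀ x : N, ∃ q : ℕ, 0 < q ∧ x ^ q ∈ S 0) {i : ℕ} {ζ : N → ℚ}
    (hadd : ∀ x ∈ ratSeries hN κ i, ∀ y ∈ ratSeries hN κ i, ζ (x * y) = ζ x + ζ y)
    (hzero : ∀ x ∈ ratSeries hN κ (i + 1), ζ x = 0)
    (hmem : ∀ x ∈ ratSeries hN κ i, (ratPow hN (κ i) (ζ x))⁻¹ * x ∈ ratSeries hN κ (i + 1))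
    {c : ℕ} {f : N → ℝ} (hf : IsPoly (ratSeries hN κ (i + 1)) (ratSeries hN κ (i + 1)) c f) :
    ∃ C, IsPoly (ratSeries hN κ i) (ratSeries hN κ i) C
      fun x => f ((ratPow hN (κ i) (ζ x))⁻¹ * x) := by
  have hanti := ratSeries_antitone hN (κ := κ)
  have hle : ratSeries hN κ (i + 1) ≤ ratSeries hN κ i := hanti (Nat.le_succ i)
  -- With `j = m` the right-invariance is vacuous, as that term is trivial. Left-invariance under
  -- `T` holds because left multiplication by a power of `κ i` from `T` changes only the factor
  -- split off.
  obtain ⟨C, hC⟩ := IsExtendedPoly.exists_isPoly (H := ratSeries hN κ i)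
    (A := fun j => ratSeries hN κ (i + 1 + j))
    (T := {t | ∃ y ∈ ratSeries hN κ i, ratPow hN (κ i) (ζ y) = t})
    (fun j => h.normal_ratSeries hN hcov _) (fun a b hab => hanti (by omega)) hle
    (fun j x hx y _ => h.comm_ratSeries hN hcov hx y)
    (fun x hx => ⟨_, ⟨x, hx, rfl⟩, hmem x hx⟩) m c
  refine ⟨C, hC _ ⟨?_, fun x hx s hs => ?_, ?_⟩⟩
  · rintro _ ⟨y, hy, rfl⟩ x hx
    have hy' := ratPow_mem_ratSeries hN (κ := κ) i (ζ y)
    have h1 := hadd _ hy' _ (hle (hmem y hy))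
    rw [mul_inv_cancel_left, hzero _ (hmem y hy), add_zero] at h1
    simp only [hadd _ hy' x hx, ← h1, ratPow_add]
    congr 1
    group
  · have : s ∈ ratSeries hN κ m := hanti (by omega) hs
    rw [h.ratSeries_eq_bot, Subgroup.mem_bot] at this
    rw [this, mul_one]
  · refine IsPoly.comp_retraction (τ := fun x => (ratPow hN (κ i) (ζ x))⁻¹ * x) hle hmem
      (fun x hx s hs => ?_) hf
    simp only [hadd x hx s (hle hs), hzero s hs, add_zero, mul_assoc]

/-- Every element is an ordered product of rational powers of the `κ i`, with exponents that are
polynomial functions. -/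
theorem IsCentralSeries.exists_coordinates (h : IsCentralSeries m S κ)
    (hcov : ∀ x : N, ∃ q : ℕ, 0 < q ∧ x ^ q ∈ S 0) : ∃ z : Fin m → N → ℚ,
      (∀ i, ∃ c, IsPoly ⊤ ⊤ c fun x => (z i x : ℝ)) ∧
      ∀ x, x = (List.ofFn fun i : Fin m => ratPow hN (κ i) (z i x)).prod := by
  choose ζ hadd hzero hmem using h.exists_exponent hN hcov
  have htop := h.ratSeries_zero hN hcov
  let σ : ℕ → N → N :=
    fun i => Nat.rec id (fun i s x => (ratPow hN (κ i) (ζ i (s x)))⁻¹ * s x) i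
  have hσ : ∀ i x, σ (i + 1) x = (ratPow hN (κ i) (ζ i (σ i x)))⁻¹ * σ i x := fun _ _ => rfl
  have hσmem : ∀ i x, σ i x ∈ ratSeries hN κ i := fun i x => by
    induction i with
    | zero => rw [htop]; trivial
    | succ i ih => exact hmem i _ ih
  have hpoly : ∀ i c f, IsPoly (ratSeries hN κ i) (ratSeries hN κ i) c f →
      ∃ C, IsPoly ⊤ ⊤ C fun x => f (σ i x) := fun i => by
    induction i with
    | zero => intro c f hf; rw [htop] at hf; exact ⟨c, hf⟩
    | succ i ih =>
      intro c f hf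
      obtain ⟨C, hC⟩ := h.exists_isPoly_comp hN hcov (hadd i) (hzero i) (hmem i) hf
      exact ih C _ hC
  -- `σ i x` is the remainder after `i` factors; `ζ i` is additive on its term, so its second
  -- differences vanish.
  refine ⟨fun i x => ζ i (σ i x), fun i => hpoly i 2 (fun x => (ζ i x : ℝ)) ?_, fun x => ?_⟩
  · intro g hg g' hg' x hx
    simp only [hadd i _ hx _ hg, hadd i _ hx _ hg', hadd i _ (Subgroup.mul_mem _ hx hg') _ hg]
    push_cast
    ring
  · have key : ∀ k (hk : k ≤ m),
        x = (List.ofFn fun i : Fin k => ratPow hN (κ i) (ζ i (σ i x))).prod * σ k x := by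
      intro k
      induction k with
      | zero => intro _; simp [σ]
      | succ k ih =>
        intro hk
        rw [List.ofFn_succ', List.concat_eq_append, List.prod_append, hσ]
        simpa [mul_assoc] using ih (by omega)
    have h1 := key m le_rfl
    have h2 := hσmem m x
    rw [h.ratSeries_eq_bot, Subgroup.mem_bot] at h2
    rwa [h2, mul_one] at h1

end Coordinates

/-! ### Exponential bounds with rational exponents. -/

namespace Generators

variable {G : Type*} [Group G] {K : Subgroup G} [K.Normal] {m n : ℕ} (D : Generators G K m n)
  {N : Type*} [Group N] {ι : K →* N} (hι : IsRationalCompletion ι)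
include hι

theorem exists_ratProd_coordinates : ∃ z : Fin m → N → ℚ,
    (∀ i, ∃ c, IsPoly ⊤ ⊤ c fun x => (z i x : ℝ)) ∧ ∀ x, x = D.ratProd hι fun i => z i x := by
  obtain ⟨S, κ, hS, h0, hκ⟩ := D.isMalcevBasis.exists_isCentralSeries
  have hcov : ∀ x : N, ∃ q : ℕ, 0 < q ∧ x ^ q ∈ (S 0).map (ι.comp D.Kbar.subtype) := fun x => by
    obtain ⟨q, hq, y, hy⟩ := hι.exists_pow_mem x
    obtain ⟨q', hq', hy'⟩ := D.exists_pow_mem y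
    refine ⟨q * q', Nat.mul_pos hq hq', ⟨y ^ q', hy'⟩, by rw [h0]; trivial, ?_⟩
    simp [← hy, pow_mul]
  obtain ⟨z, hz, hprod⟩ :=
    (hS.map (ι.comp D.Kbar.subtype)).exists_coordinates hι.radicable hcov
  refine ⟨z, hz, fun x => (hprod x).trans ?_⟩
  rw [ratProd]
  congr 2
  funext i
  simp [hκ]

theorem ratProd_zero : D.ratProd hι 0 = 1 := by
  simp [ratProd, ratPow_zero, List.ofFn_const]

theorem exists_ratProd_of_mem_wordBall_gensGbar :
    ∃ C : ℝ, 1 ≤ C ∧ ∀ r : ℝ, 0 < r → ∀ g : K, (g : G) ∈ wordBall D.gensGbar r →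
      ∃ z : Fin m → ℚ, ι g = D.ratProd hι z ∧ ∀ i, |(z i : ℝ)| ≤ C ^ r := by
  obtain ⟨z, hz, hprod⟩ := D.exists_ratProd_coordinates hι
  choose c hc using hz
  choose C hC1 hC using fun i => D.exists_abs_le_rpow_of_isPoly (f := fun g => (z i (ι g) : ℝ))
    (IsPoly.comp (H := ⊤) (D := ⊤) ι (fun _ _ => trivial) (fun _ _ => trivial) (hc i))
  have hC0 : ∀ i, 0 ≤ C i := fun i => zero_le_one.trans (hC1 i)
  have hsum : 0 ≤ ∑ i, C i := Finset.sum_nonneg fun i _ => hC0 i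
  refine ⟨1 + ∑ i, C i, by linarith, fun r hr g hg => ?_⟩
  -- The growth estimate needs `1 ≤ r`; a smaller ball contains only `1`, written with zero
  -- exponents.
  rcases lt_or_ge r 1 with hr1 | hr1
  · obtain rfl : g = 1 := Subtype.ext (eq_one_of_mem_wordBall hr1 hg)
    refine ⟨0, by rw [ratProd_zero, map_one], fun i => ?_⟩
    simp only [Pi.zero_apply, Rat.cast_zero, abs_zero]
    positivity
  · refine ⟨_, hprod (ι g), fun i => (hC i r hr1 g hg).trans ?_⟩
    refine Real.rpow_le_rpow (hC0 i) ?_ hr.le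
    have := Finset.single_le_sum (f := C) (fun i _ => hC0 i) (Finset.mem_univ i)
    linarith

theorem exists_ratProd_of_mem_wordBall_gensG :
    ∃ C : ℝ, 1 ≤ C ∧ ∀ r : ℝ, 0 < r → ∀ g : K, (g : G) ∈ wordBall D.gensG r →
      ∃ z : Fin m → ℚ, ι g = D.ratProd hι z ∧ ∀ i, |(z i : ℝ)| ≤ C ^ r := by
  obtain ⟨c, hc0, hc⟩ := D.exists_mem_wordBall_gensGbar
  obtain ⟨C, hC1, hC⟩ := D.exists_ratProd_of_mem_wordBall_gensGbar hι
  have hc0' : (0 : ℝ) < c := by exact_mod_cast hc0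
  refine ⟨C ^ (c : ℝ), Real.one_le_rpow hC1 hc0'.le, fun r hr g hg => ?_⟩
  obtain ⟨z, hz, hb⟩ := hC (c * r) (by positivity) g (hc r g hg)
  exact ⟨z, hz, fun i => (hb i).trans_eq (Real.rpow_mul (zero_le_one.trans hC1) _ _)⟩

end Generators

end MGroup

theorem mainTheorem7 {G : Type*} [Group G] (K : Subgroup G) [K.Normal]
    (hG : MGroup.IsMExtension G K) {m n : ℕ} (D : MGroup.Generators G K m n) :
    -- exponential bounds, with coordinates in the rational completion `N` of `K`
    (∀ {N : Type*} [Group N] (ι : K →* N) (hι : MGroup.IsRationalCompletion ι),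
      (∃ C : ℝ, 0 < C ∧ ∀ r : ℝ, 0 < r → ∀ g : K, (g : G) ∈ MGroup.wordBall D.gensG r →
        ∃ z : Fin m → ℚ, ι g = D.ratProd hι z ∧ ∀ i, |(z i : ℝ)| ≤ C ^ r) ∧
      (∃ C : ℝ, 0 < C ∧ ∀ r : ℝ, 0 < r → ∀ g : K, (g : G) ∈ MGroup.wordBall D.gensGbar r →
        ∃ z : Fin m → ℚ, ι g = D.ratProd hι z ∧ ∀ i, |(z i : ℝ)| ≤ C ^ r)) ∧
    -- polynomial bound in `G` if `H = G ⧸ K` is finite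
    (Finite (G ⧸ K) →
      ∃ C' : ℝ, 0 < C' ∧ ∀ r : ℝ, 0 < r → ∀ g : K, (g : G) ∈ MGroup.wordBall D.gensG r →
        ∃ z : Fin m → ℤ, g = D.intProd z ∧ ∀ i, |(z i : ℝ)| ≤ C' * r ^ (m ^ m)) ∧
    -- polynomial bound in `K` if `K` equals its subgroup generated by the `k_i`
    (D.Kbar = ⊤ →
      ∃ C' : ℝ, 0 < C' ∧ ∀ r : ℝ, 0 < r → ∀ g : K, g ∈ MGroup.wordBall D.gensK r →
        ∃ z : Fin m → ℤ, g = D.intProd z ∧ ∀ i, |(z i : ℝ)| ≤ C' * r ^ (m ^ m)) := by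
  refine ⟨fun ι hι => ⟨?_, ?_⟩, fun _ => D.exists_intProd_of_finite,
    fun _ => D.exists_intProd_of_mem_wordBall_gensK⟩
  · obtain ⟨C, hC, h⟩ := D.exists_ratProd_of_mem_wordBall_gensG hι
    exact ⟨C, zero_lt_one.trans_le hC, h⟩
  · obtain ⟨C, hC, h⟩ := D.exists_ratProd_of_mem_wordBall_gensGbar hι
    exact ⟨C, zero_lt_one.trans_le hC, h⟩
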